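/- Let $K$ be a field of characteristic $0$, let $q\in K^\times$, $t\in K^\times$ with a chosen square root $t^{1/2}\in K$, and assume that $q^m t^n\neq 1$ for all integers $m,n\ge 0$ with $(m,n)\ne(0,0)$ (for example $q$ and $t^{1/2}$ indeterminates). For a partition $\lambda$ with conjugate $\lambda^\vee$ and length $\ell(\lambda)$, let, for $n\ge 1$, $$p_n(q^\lambda t^\rho)=\sum_{i=1}^{\ell(\lambda)}(q^{n\lambda_i}-1)t^{n(1/2-i)}+\frac1{t^{n/2}-t^{-n/2}},$$ $$p_n(Qq^\lambda t^\rho,t^{-\rho})=Q^n\sum_{i=1}^{\ell(\lambda)}(q^{n\lambda_i}-1)t^{n(1/2-i)}+\frac{Q^n-1}{t^{n/2}-t^{-n/2}} .$$ A symmetric function is evaluated at $q^\lambda t^\rho$ or at $(Qq^\lambda t^\rho,t^{-\rho})$ by writing it as a polynomial in the power sums $p_n$ and inserting these values; the argument $Qt^\rho$ means $Qq^\lambda t^\rho$ with $\lambda$ empty. Let $e_r$ be the elementary symmetric functions, $\sum_{r\ge0}(-w)^r e_r=\exp\bigl(-\sum_{n>0}p_nw^n/n\bigr)$, and let $s_\lambda$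 be the Schur functions. Define the formal power series in $Q$, the sum being over all partitions $\eta$, $$Z_{\lambda,\mu}(Q;q,t)=\sum_\eta s_\lambda(q^\eta t^\rho)\,s_\mu(q^\eta t^\rho)\prod_{(i,j)\in\eta}\frac{Q}{(1-q^{\eta_i-j+1}t^{\eta^\vee_j-i})(1-q^{-\eta_i+j}t^{-\eta^\vee_j+i-1})},$$ and write $\bullet$ for the empty partition and $1^r$ for the partition consisting of $r$ ones. Then $Z_{\bullet,\bullet}(Q;q,t)$ is invertible in $K[[Q]]$, and for all integers $r,s\ge 0$ $$\frac{Z_{1^r,1^s}(Q;q,t)}{Z_{\bullet,\bullet}(Q;q,t)}=f(1^r)\,f(1^s)\,e_r(Qt^\rho,t^{-\rho})\,e_s(Qq^{(1^r)}t^\rho,t^{-\rho}),\qquad f(1^r)=(-1)^r t^{-r(r-1)/2}.$$ This is a polynomial in $Q$ of degree at most $r+s$, and of degree exactly $r+s$ when $q$ and $t$ are algebraically independent over $\mathbb Q$. -/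

import Mathlib

open Polynomial PowerSeries

namespace HopfLink

noncomputable section

/-! ### Symmetric functions as functions of the power sums

A symmetric function is evaluated on a sequence `p : ℕ → A` of values of the power sums
`p 1, p 2, …` in a commutative `ℚ`-algebra `A` (the value `p 0` is never used). -/

section SymmetricFunctions

variable {A : Type*} [CommRing A] [Algebra ℚ A]

/-- The formal power series `∑_{n > 0} p_n wⁿ / n` in `w`. -/
def powerSumSeries (p : ℕ → A) : PowerSeries A :=
  PowerSeries.mk fun n => if n = 0 then 0 else (n : ℚ)⁻¹ • p n

/-- The elementary symmetric function `e_r` in terms of the power sums: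
`∑_r (-w)^r e_r = exp (-∑_{n > 0} p_n wⁿ / n)`. -/
def elemSymm (p : ℕ → A) (r : ℕ) : A :=
  (-1) ^ r * PowerSeries.coeff r ((PowerSeries.exp A).subst (-powerSumSeries p))

/-- The complete homogeneous symmetric function `h_r` in terms of the power sums:
`∑_r w^r h_r = exp (∑_{n > 0} p_n wⁿ / n)`. -/
def complSymm (p : ℕ → A) (r : ℕ) : A :=
  PowerSeries.coeff r ((PowerSeries.exp A).subst (powerSumSeries p))

/-- `h_k` for an integer index, with `h_k = 0` for `k < 0`. -/
def complSymmInt (p : ℕ → A) (k : ℤ) : A :=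
  if 0 ≤ k then complSymm p k.toNat else 0

/-- The Schur function `s_λ` in terms of the power sums (Jacobi–Trudi determinant):
`s_λ = det (h_{λ_i - i + j})`, `1 ≤ i, j ≤ ℓ(λ)`. -/
def schur (p : ℕ → A) (lam : YoungDiagram) : A :=
  Matrix.det (Matrix.of fun i j : Fin (lam.colLen 0) =>
    complSymmInt p ((lam.rowLen i : ℤ) - (i : ℤ) + (j : ℤ)))

end SymmetricFunctions

/-! ### Young diagrams -/

/-- The Young diagram `1^r`: a single column of `r` boxes. -/
def column (r : ℕ) : YoungDiagram where
  cells := Finset.range r ×ˢ Finset.range 1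
  isLowerSet := by
    intro a b hab ha
    simp only [Finset.coe_product, Set.mem_prod, Finset.mem_coe, Finset.mem_range] at ha ⊢
    exact ⟨lt_of_le_of_lt hab.1 ha.1, lt_of_le_of_lt hab.2 ha.2⟩

/-- There are finitely many Young diagrams with `n` boxes. -/
theorem finite_setOf_card_eq (n : ℕ) : {eta : YoungDiagram | eta.card = n}.Finite := by
  have key : ∀ eta : YoungDiagram, eta.card = n →
      eta.cells ∈ (Finset.range n ×ˢ Finset.range n).powerset := by
    intro eta h
    rw [Finset.mem_powerset]
    rintro ⟨i, j⟩ hc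
    have hc' : (i, j) ∈ eta := hc
    have h1 : eta.colLen j ≤ n := by
      rw [YoungDiagram.colLen_eq_card, ← h]
      exact Finset.card_le_card (Finset.filter_subset _ _)
    have h2 : eta.rowLen i ≤ n := by
      rw [YoungDiagram.rowLen_eq_card, ← h]
      exact Finset.card_le_card (Finset.filter_subset _ _)
    have h3 := YoungDiagram.mem_iff_lt_colLen.1 hc'
    have h4 := YoungDiagram.mem_iff_lt_rowLen.1 hc'
    simp only [Finset.mem_product, Finset.mem_range]
    omega
  refine Set.Finite.of_finite_image (f := YoungDiagram.cells)
    ((Finset.finite_toSet (Finset.range n ×ˢ Finset.range n).powerset).subset ?_) ?_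
  · rintro _ ⟨eta, h, rfl⟩
    exact key eta h
  · intro a _ b _ hab
    exact YoungDiagram.ext hab

/-- The finite set of all Young diagrams with `n` boxes. -/
def diagramsOfSize (n : ℕ) : Finset YoungDiagram := (finite_setOf_card_eq n).toFinset

/-! ### Specializations and the generating function

Below `q` and `τ` are elements of a field and `t = τ ^ 2`, so that `τ` is the square root
`t^{1/2}`. -/

section Specialization

variable {K : Type*} [Field K]

/-- The value
`p_n(q^λ t^ρ) = ∑_{i=1}^{ℓ(λ)} (q^{n λ_i} - 1) t^{n(1/2 - i)} + 1 / (t^{n/2} - t^{-n/2})`.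
Row `i` of the formula is row `i - 1` of `λ` here, and `t^{n(1/2 - (i+1))} = τ^{-n(2i+1)}`. -/
def powerSumSpec (q τ : K) (lam : YoungDiagram) (n : ℕ) : K :=
  (∑ i ∈ Finset.range (lam.colLen 0),
      (q ^ (n * lam.rowLen i) - 1) * τ ^ (-((n : ℤ) * (2 * (i : ℤ) + 1))))
    + 1 / (τ ^ n - (τ ^ n)⁻¹)

/-- The value
`p_n(Q q^λ t^ρ, t^{-ρ}) = Q^n ∑_{i=1}^{ℓ(λ)} (q^{n λ_i} - 1) t^{n(1/2 - i)}
  + (Q^n - 1) / (t^{n/2} - t^{-n/2})`, a polynomial in the variable `Q`. -/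
def powerSumSpecQ (q τ : K) (lam : YoungDiagram) (n : ℕ) : K[X] :=
  Polynomial.X ^ n * Polynomial.C (∑ i ∈ Finset.range (lam.colLen 0),
      (q ^ (n * lam.rowLen i) - 1) * τ ^ (-((n : ℤ) * (2 * (i : ℤ) + 1))))
    + (Polynomial.X ^ n - 1) * Polynomial.C (1 / (τ ^ n - (τ ^ n)⁻¹))

/-- The product over the boxes `(i, j) ∈ η` of
`1 / ((1 - q^{η_i - j + 1} t^{η^∨_j - i}) (1 - q^{-η_i + j} t^{-η^∨_j + i - 1}))`.
The rows and columns of `η` are numbered from `0` here, from `1` in the formula. -/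
def boxWeight (q τ : K) (eta : YoungDiagram) : K :=
  ∏ c ∈ eta.cells,
    1 / ((1 - q ^ ((eta.rowLen c.1 : ℤ) - (c.2 : ℤ))
              * (τ ^ 2) ^ ((eta.colLen c.2 : ℤ) - (c.1 : ℤ) - 1))
        * (1 - q ^ (-(eta.rowLen c.1 : ℤ) + (c.2 : ℤ) + 1)
              * (τ ^ 2) ^ (-(eta.colLen c.2 : ℤ) + (c.1 : ℤ))))

/-- `Z_{λ,μ}(Q; q, t) = ∑_η s_λ(q^η t^ρ) s_μ(q^η t^ρ) ∏_{(i,j) ∈ η} Q / (⋯)`, a formal power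
series in `Q`; the coefficient of `Q^n` is the sum over the diagrams `η` with `n` boxes. -/
def Z [CharZero K] (q τ : K) (lam mu : YoungDiagram) : PowerSeries K :=
  PowerSeries.mk fun n => ∑ eta ∈ diagramsOfSize n,
    schur (powerSumSpec q τ eta) lam * schur (powerSumSpec q τ eta) mu * boxWeight q τ eta

/-- `f(1^r) = (-1)^r t^{-r(r-1)/2}`. -/
def framing (t : K) (r : ℕ) : K := (-1) ^ r * (t ^ (r * (r - 1) / 2))⁻¹

end Specialization

end

end HopfLink

/-! Put t = τ², x_i = q^{η_i} τ^{-(2i+1)} and E_r(η) = (-1)^r e_r(q^η t^ρ). Formally ∑ E_r w^r = ∏_i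
(1 - x_i w). Rescaling w by t^{±1} shifts the tail of empty rows by one step, so only finitely many
factors change, and partial fractions expand the result over the rows i in terms of the series with
factor i removed. The scale t⁻¹ produces `upCoeff`, supported on rows where a box can be added; the
scale t produces `downCoeff`, supported on rows where a box can be removed (`sum_upCoeff_mul`,
`X_mul_sum_downCoeff_mul`).

The weights obey the detailed balance `boxWeight_mul_upCoeff`: a new box affects only the hooks in
its row and column, and the changes telescope. Hence, with γ_r = τ⁻¹(t^{r+1} - 1), the weighted sum
of (E_r + γ_r E_{r+1}) E_s over diagrams with n + 1 boxes becomes a sum over diagrams with n boxes.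
That sum has a part quadratic in the erased coefficients. The part becomes linear for s = 0, and
also in the difference of the index pairs (r, s + 1) and (r + 1, s) (`eraseCoeff_cross`). The
outcome is `HopfRecursion`, which together with the symmetry in r and s leaves only the value at (0,
0) free (`HopfRecursion.unique`).

The closed form satisfies the same recursion (`columnCoeff_three_term`, `hopfRecursion_columnCoeff`)
and equals 1 at (0, 0), so it is the quotient of correlators. Its coefficient of Q^{r+s} is, up to a
unit, e_r(t^ρ) e_s(q^{(1^r)} t^ρ). The first factor is nonzero by a two-term recursion; the second
is, up to a power of τ, a polynomial in q over ℚ(t) that does not vanish at q = 1. -/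

namespace HopfLink

noncomputable section

/-! ### Generating series in the power sums, and Schur functions of columns -/

section GeneratingSeries

variable {A : Type*} [CommRing A] [Algebra ℚ A]

/-- The series `exp (-∑_{n > 0} p_n wⁿ / n)`, whose `r`-th coefficient is `(-1) ^ r e_r`. -/
def genSeries (p : ℕ → A) : PowerSeries A :=
  (PowerSeries.exp A).subst (-powerSumSeries p)

theorem isAddTorsionFree_of_rat : IsAddTorsionFree A where
  nsmul_right_injective n hn a b hab := by
    have h : ((n : ℚ)⁻¹ * n) • a = ((n : ℚ)⁻¹ * n) • b := by
      simp only [mul_smul, Nat.cast_smul_eq_nsmul]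
      exact congrArg _ hab
    rwa [inv_mul_cancel₀ (by exact_mod_cast hn), one_smul, one_smul] at h

theorem hasSubst_powerSumSeries (p : ℕ → A) : PowerSeries.HasSubst (powerSumSeries p) :=
  PowerSeries.HasSubst.of_constantCoeff_zero' (by
    rw [← PowerSeries.coeff_zero_eq_constantCoeff_apply]; simp [powerSumSeries])

theorem powerSumSeries_neg (p : ℕ → A) :
    powerSumSeries (fun n => -p n) = -powerSumSeries p := by
  ext n
  by_cases h : n = 0 <;> simp [powerSumSeries, h]

theorem derivative_powerSumSeries (p : ℕ → A) :
    PowerSeries.derivative A (powerSumSeries p) = PowerSeries.mk fun n => p (n + 1) := by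
  ext n
  have h : ((n : ℚ) + 1) ≠ 0 := by positivity
  rw [PowerSeries.coeff_derivative]
  simp only [powerSumSeries, PowerSeries.coeff_mk, Nat.succ_ne_zero, if_false]
  have : ((n : A) + 1) = algebraMap ℚ A ((n : ℚ) + 1) := by simp
  rw [this, mul_comm, ← Algebra.smul_def, smul_smul]
  push_cast
  rw [mul_inv_cancel₀ h, one_smul]

theorem derivative_genSeries (p : ℕ → A) :
    PowerSeries.derivative A (genSeries p)
      = -(PowerSeries.mk fun n => p (n + 1)) * genSeries p := by
  have h := hasSubst_powerSumSeries (fun n => -p n)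
  rw [powerSumSeries_neg] at h
  rw [genSeries, PowerSeries.derivative_subst h, PowerSeries.derivative_exp, map_neg,
    derivative_powerSumSeries, mul_comm]

@[simp]
theorem constantCoeff_genSeries (p : ℕ → A) : PowerSeries.constantCoeff (genSeries p) = 1 := by
  have h := hasSubst_powerSumSeries (fun n => -p n)
  rw [powerSumSeries_neg] at h
  have h0 : PowerSeries.constantCoeff (-powerSumSeries p) = 0 := by
    rw [map_neg, ← PowerSeries.coeff_zero_eq_constantCoeff_apply]; simp [powerSumSeries]
  have h1 : PowerSeries.constantCoeff ((PowerSeries.exp A - 1).subst (-powerSumSeries p)) = 0 :=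
    PowerSeries.constantCoeff_subst_eq_zero h0 _ (by simp)
  rw [← PowerSeries.coe_substAlgHom h, map_sub, map_one, map_sub, map_one, sub_eq_zero] at h1
  rw [genSeries, ← PowerSeries.coe_substAlgHom h, h1]

@[simp]
theorem coeff_zero_genSeries (p : ℕ → A) : PowerSeries.coeff 0 (genSeries p) = 1 := by
  rw [PowerSeries.coeff_zero_eq_constantCoeff_apply, constantCoeff_genSeries]

/-- Newton's identities. -/
theorem newton_genSeries (p : ℕ → A) (n : ℕ) :
    ((n : A) + 1) * PowerSeries.coeff (n + 1) (genSeries p)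
      = -∑ k ∈ Finset.range (n + 1), p (k + 1) * PowerSeries.coeff (n - k) (genSeries p) := by
  have h := congrArg (PowerSeries.coeff n) (derivative_genSeries p)
  rw [PowerSeries.coeff_derivative, neg_mul, map_neg, PowerSeries.coeff_mul,
    Finset.Nat.sum_antidiagonal_eq_sum_range_succ_mk] at h
  rw [mul_comm, h]
  simp

/-- A series is determined by its logarithmic derivative and its constant coefficient. -/
theorem eq_genSeries {p : ℕ → A} {f : PowerSeries A} (h0 : PowerSeries.constantCoeff f = 1)
    (h1 : PowerSeries.derivative A f = -(PowerSeries.mk fun n => p (n + 1)) * f) :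
    f = genSeries p := by
  have hnat : ∀ (n : ℕ) (a b : A), ((n : A) + 1) * a = ((n : A) + 1) * b → a = b := by
    intro n a b hab
    have := isAddTorsionFree_of_rat (A := A)
    refine nsmul_right_injective (n := n + 1) (by omega) ?_
    simpa [nsmul_eq_mul] using hab
  have newton (n : ℕ) : ((n : A) + 1) * PowerSeries.coeff (n + 1) f
      = -∑ k ∈ Finset.range (n + 1), p (k + 1) * PowerSeries.coeff (n - k) f := by
    have h := congrArg (PowerSeries.coeff n) h1
    rw [PowerSeries.coeff_derivative, neg_mul, map_neg, PowerSeries.coeff_mul,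
      Finset.Nat.sum_antidiagonal_eq_sum_range_succ_mk] at h
    rw [mul_comm, h]
    simp
  ext n
  induction n using Nat.strong_induction_on with
  | _ n ih =>
    rcases n with _ | n
    · simpa using h0
    · refine hnat n _ _ ?_
      rw [newton, newton_genSeries]
      congr 1
      exact Finset.sum_congr rfl fun k _ => by rw [ih (n - k) (by omega)]

/-- The logarithmic derivative never sees `p 0`, so default values there, such as a division by zero
in `powerSumSpec`, are harmless. -/
theorem genSeries_congr {p p' : ℕ → A} (h : ∀ n, p (n + 1) = p' (n + 1)) :
    genSeries p = genSeries p' := by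
  apply eq_genSeries (constantCoeff_genSeries p)
  rw [derivative_genSeries]
  simp [h]

/-- Adjoining a variable `c` to the alphabet multiplies the series by `1 - c w`. -/
theorem genSeries_add_pow (p : ℕ → A) (c : A) :
    genSeries (fun n => p n + c ^ n) = (1 - PowerSeries.C c * PowerSeries.X) * genSeries p := by
  symm
  apply eq_genSeries
  · simp
  · have key : (PowerSeries.mk fun n => c ^ (n + 1)) * (1 - PowerSeries.C c * PowerSeries.X)
        = PowerSeries.C c := by
      ext n
      rw [mul_sub, mul_one, mul_left_comm, map_sub, PowerSeries.coeff_C_mul]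
      rcases n with _ | n
      · simp
      · rw [PowerSeries.coeff_succ_mul_X]
        simp
        ring
    have hsum : (PowerSeries.mk fun n => p (n + 1) + c ^ (n + 1))
        = PowerSeries.mk (fun n => p (n + 1)) + PowerSeries.mk fun n => c ^ (n + 1) := by
      ext n; simp
    have hd : PowerSeries.derivative A (1 - PowerSeries.C c * PowerSeries.X) = -PowerSeries.C c := by
      ext n
      rw [PowerSeries.coeff_derivative]
      rcases n with _ | n
      · simp [PowerSeries.coeff_one]
      · simp [PowerSeries.coeff_one]
    rw [Derivation.leibniz, smul_eq_mul, smul_eq_mul, derivative_genSeries, hd, hsum]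
    linear_combination genSeries p * key

theorem genSeries_add_sum_pow {ι : Type*} (s : Finset ι) (p : ℕ → A) (c : ι → A) :
    genSeries (fun n => p n + ∑ i ∈ s, c i ^ n)
      = (∏ i ∈ s, (1 - PowerSeries.C (c i) * PowerSeries.X)) * genSeries p := by
  classical
  induction s using Finset.induction_on with
  | empty => simp
  | insert i s hi ih =>
    rw [Finset.prod_insert hi, mul_assoc, ← ih, ← genSeries_add_pow]
    congr 1
    ext n
    rw [Finset.sum_insert hi]
    ring

theorem genSeries_scale (p : ℕ → A) (u : A) :
    genSeries (fun n => u ^ n * p n) = PowerSeries.rescale u (genSeries p) := by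
  symm
  apply eq_genSeries
  · rw [← PowerSeries.coeff_zero_eq_constantCoeff_apply]; simp
  · ext n
    have h := newton_genSeries p n
    rw [PowerSeries.coeff_derivative, neg_mul, map_neg, PowerSeries.coeff_mul,
      Finset.Nat.sum_antidiagonal_eq_sum_range_succ_mk, PowerSeries.coeff_rescale]
    have : ∑ k ∈ Finset.range n.succ, PowerSeries.coeff k
        (PowerSeries.mk fun n => u ^ (n + 1) * p (n + 1)) *
          PowerSeries.coeff (n - k) (PowerSeries.rescale u (genSeries p))
        = u ^ (n + 1) * ∑ k ∈ Finset.range (n + 1),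
          p (k + 1) * PowerSeries.coeff (n - k) (genSeries p) := by
      rw [Finset.mul_sum]
      refine Finset.sum_congr rfl fun k hk => ?_
      have hk' := Finset.mem_range.1 hk
      rw [PowerSeries.coeff_mk, PowerSeries.coeff_rescale,
        show n + 1 = (k + 1) + (n - k) by omega, pow_add u (k + 1) (n - k)]
      ring
    simp only at this ⊢
    rw [this]
    linear_combination u ^ (n + 1) * h

theorem map_genSeries {B : Type*} [CommRing B] [Algebra ℚ B] (φ : A →+* B) (p : ℕ → A) :
    PowerSeries.map φ (genSeries p) = genSeries fun n => φ (p n) := by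
  apply eq_genSeries
  · rw [← PowerSeries.coeff_zero_eq_constantCoeff_apply]; simp
  · ext n
    have h := congrArg φ (newton_genSeries p n)
    rw [PowerSeries.coeff_derivative, neg_mul, map_neg, PowerSeries.coeff_mul,
      Finset.Nat.sum_antidiagonal_eq_sum_range_succ_mk, PowerSeries.coeff_map]
    simpa [mul_comm] using h

theorem elemSymm_eq (p : ℕ → A) (r : ℕ) :
    elemSymm p r = (-1) ^ r * PowerSeries.coeff r (genSeries p) := rfl

theorem complSymm_eq (p : ℕ → A) (r : ℕ) :
    complSymm p r = PowerSeries.coeff r (genSeries fun n => -p n) := by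
  rw [genSeries, powerSumSeries_neg, neg_neg, complSymm]

theorem genSeries_neg_mul (p : ℕ → A) : genSeries (fun n => -p n) * genSeries p = 1 := by
  have h1 : (1 : PowerSeries A) = genSeries fun _ => 0 := by
    apply eq_genSeries
    · simp
    · have : (PowerSeries.mk fun _ : ℕ => (0 : A)) = 0 := by ext; simp
      simp [this]
  rw [h1]
  apply eq_genSeries
  · simp
  · have : (PowerSeries.mk fun _ : ℕ => (0 : A)) = 0 := by ext; simp
    have h2 : (PowerSeries.mk fun n => -p (n + 1)) = -PowerSeries.mk fun n => p (n + 1) := by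
      ext n; simp
    rw [Derivation.leibniz, smul_eq_mul, smul_eq_mul, derivative_genSeries, derivative_genSeries,
      this, h2]
    ring

@[simp]
theorem mem_column {r i j : ℕ} : (i, j) ∈ column r ↔ i < r ∧ j = 0 := by
  rw [← YoungDiagram.mem_cells, column]
  simp [eq_comm]

theorem column_zero : column 0 = ⊥ := by
  apply YoungDiagram.ext
  ext ⟨i, j⟩
  simp [column]

@[simp]
theorem colLen_column_zero (r : ℕ) : (column r).colLen 0 = r := by
  refine eq_of_forall_lt_iff fun i => ?_
  rw [← YoungDiagram.mem_iff_lt_colLen]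
  simp

theorem rowLen_column (r i : ℕ) : (column r).rowLen i = if i < r then 1 else 0 := by
  refine eq_of_forall_lt_iff fun j => ?_
  rw [← YoungDiagram.mem_iff_lt_rowLen]
  split_ifs with h <;> simp [h]

/-- The Toeplitz matrix of the complete symmetric functions is inverse to that of the signed
elementary ones, and the minor that computes `s_{1^r}` is a cofactor of it. -/
theorem schur_column (p : ℕ → A) (r : ℕ) : schur p (column r) = elemSymm p r := by
  set e : ℕ → A := fun k => PowerSeries.coeff k (genSeries p)
  let H : Matrix (Fin (r + 1)) (Fin (r + 1)) A :=
    Matrix.of fun i j => complSymmInt p ((j : ℤ) - i)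
  let E : Matrix (Fin (r + 1)) (Fin (r + 1)) A :=
    Matrix.of fun i j => if (i : ℕ) ≤ j then e (j - i) else 0
  have hneg : ∀ k : ℤ, k < 0 → complSymmInt p k = 0 := fun k hk => by
    rw [complSymmInt, if_neg (by omega)]
  have hnat : ∀ k : ℕ, complSymmInt p k = complSymm p k := fun k => by
    simp [complSymmInt]
  have h0 : complSymmInt p 0 = 1 := by
    have := hnat 0
    rw [Nat.cast_zero] at this
    rw [this, complSymm_eq, coeff_zero_genSeries]
  have hdet : H.det = 1 := by
    rw [Matrix.det_of_isUpperTriangular]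
    · simp [H, h0]
    · intro i j hij
      exact hneg _ (by have : (j : ℕ) < i := hij; omega)
  have hHE : H * E = 1 := by
    ext i j
    rw [Matrix.mul_apply]
    simp only [H, E, Matrix.of_apply]
    rw [Fin.sum_univ_eq_sum_range
      (fun k => complSymmInt p ((k : ℤ) - i) * if k ≤ (j : ℕ) then e (j - k) else 0)]
    by_cases hij : (i : ℕ) ≤ j
    · have h1 := congrArg (PowerSeries.coeff ((j : ℕ) - i)) (genSeries_neg_mul p)
      rw [PowerSeries.coeff_mul, Finset.Nat.sum_antidiagonal_eq_sum_range_succ_mk,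
        PowerSeries.coeff_one] at h1
      have hs : Finset.Ico (i : ℕ) (j + 1) ⊆ Finset.range (r + 1) := fun k hk => by
        simp only [Finset.mem_Ico, Finset.mem_range] at hk ⊢; omega
      rw [← Finset.sum_subset hs, Finset.sum_Ico_eq_sum_range]
      · have hone : (1 : Matrix (Fin (r + 1)) (Fin (r + 1)) A) i j
            = if (j : ℕ) - i = 0 then 1 else 0 := by
          rw [Matrix.one_apply]
          congr 1
          simp only [Fin.ext_iff, eq_iff_iff]; omega
        rw [hone, ← h1, show (j : ℕ) + 1 - i = ((j : ℕ) - i).succ by omega]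
        refine Finset.sum_congr rfl fun k hk => ?_
        have hk' := Finset.mem_range.1 hk
        rw [if_pos (by omega), show (((i : ℕ) + k : ℕ) : ℤ) - i = (k : ℕ) by push_cast; ring, hnat,
          complSymm_eq, show (j : ℕ) - (i + k) = j - i - k by omega]
      · intro k _ hk
        simp only [Finset.mem_Ico, not_and_or, not_le, not_lt] at hk
        rcases hk with hk | hk
        · rw [hneg _ (by omega), zero_mul]
        · rw [if_neg (by omega), mul_zero]
    · rw [Matrix.one_apply_ne (fun h => hij (by rw [h]))]
      refine Finset.sum_eq_zero fun k _ => ?_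
      by_cases hk : k ≤ (j : ℕ)
      · rw [hneg _ (by omega), zero_mul]
      · rw [if_neg hk, mul_zero]
  have hadj : H.adjugate = E := by
    calc H.adjugate = H.adjugate * (H * E) := by rw [hHE, mul_one]
      _ = E := by rw [← mul_assoc, Matrix.adjugate_mul, hdet, one_smul, one_mul]
  have h2 := Matrix.adjugate_fin_succ_eq_det_submatrix H 0 (Fin.last r)
  rw [hadj] at h2
  have hE : E 0 (Fin.last r) = e r := by simp [E]
  rw [hE] at h2
  -- Deleting the last row and the first column of the Toeplitz matrix raises the index by one,
  -- which turns h_{j-i} into the Jacobi–Trudi entry h_{1-i+j}.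
  have h3 : schur p (column r)
      = (H.submatrix (Fin.last r).succAbove (0 : Fin (r + 1)).succAbove).det := by
    rw [schur]
    rw [← Matrix.det_reindex_self (finCongr (colLen_column_zero r).symm)]
    congr 1
    ext i j
    have hi : ((finCongr (colLen_column_zero r)) i : ℕ) = i := rfl
    have hir : (i : ℕ) < r := i.2.trans_eq (colLen_column_zero r)
    simp only [H, Matrix.of_apply, Matrix.reindex_apply, Matrix.submatrix_apply,
      rowLen_column, hir, if_true]
    congr 1
    simp [Fin.succAbove_last]
    ring
  rw [h3, elemSymm_eq]
  change _ = (-1) ^ r * e r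
  rw [h2]
  simp [← mul_assoc, ← mul_pow]

theorem schur_bot (p : ℕ → A) : schur p ⊥ = 1 := by
  rw [← column_zero, schur_column, elemSymm_eq]
  simp

end GeneratingSeries

/-! ### Adding and removing boxes of Young diagrams -/

section Diagrams

theorem mem_diagramsOfSize {n : ℕ} {eta : YoungDiagram} :
    eta ∈ diagramsOfSize n ↔ eta.card = n := by
  simp [diagramsOfSize]

/-- A box can be added at the end of row `i`. -/
def Addable (eta : YoungDiagram) (i : ℕ) : Prop := ∀ k < i, eta.rowLen i < eta.rowLen k

/-- A box can be removed from the end of row `i`. -/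
def Removable (theta : YoungDiagram) (i : ℕ) : Prop := theta.rowLen (i + 1) < theta.rowLen i

/-- The diagram with a box added to row `i`. -/
def addBox (eta : YoungDiagram) (i : ℕ) (h : Addable eta i) : YoungDiagram where
  cells := insert (i, eta.rowLen i) eta.cells
  isLowerSet := by
    rintro ⟨a1, a2⟩ ⟨b1, b2⟩ hab ha
    obtain ⟨h1, h2⟩ : b1 ≤ a1 ∧ b2 ≤ a2 := hab
    simp only [Finset.coe_insert, Set.mem_insert_iff, Prod.mk.injEq, Finset.mem_coe,
      YoungDiagram.mem_cells, YoungDiagram.mem_iff_lt_rowLen] at ha ⊢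
    rcases ha with ⟨rfl, rfl⟩ | ha
    · rcases h1.lt_or_eq with h3 | rfl
      · exact Or.inr (h2.trans_lt (h _ h3))
      · rcases h2.lt_or_eq with h4 | rfl
        · exact Or.inr h4
        · exact Or.inl ⟨rfl, rfl⟩
    · exact Or.inr (h2.trans_lt (ha.trans_le (eta.rowLen_anti _ _ h1)))

/-- The diagram with a box removed from row `i`. -/
def removeBox (theta : YoungDiagram) (i : ℕ) (h : Removable theta i) : YoungDiagram where
  cells := theta.cells.erase (i, theta.rowLen i - 1)
  isLowerSet := by
    rintro ⟨a1, a2⟩ ⟨b1, b2⟩ hab ha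
    obtain ⟨h1, h2⟩ : b1 ≤ a1 ∧ b2 ≤ a2 := hab
    simp only [Finset.coe_erase, Set.mem_sdiff, Finset.mem_coe, YoungDiagram.mem_cells,
      YoungDiagram.mem_iff_lt_rowLen, Set.mem_singleton_iff, Prod.mk.injEq, not_and] at ha ⊢
    refine ⟨h2.trans_lt (ha.1.trans_le (theta.rowLen_anti _ _ h1)), ?_⟩
    rintro rfl rfl
    have h' : theta.rowLen (b1 + 1) < theta.rowLen b1 := h
    rcases h1.lt_or_eq with h3 | rfl
    · have := theta.rowLen_anti (b1 + 1) a1 h3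
      omega
    · have := ha.2 rfl
      omega

variable {eta : YoungDiagram} {i : ℕ}

theorem rowLen_addBox (h : Addable eta i) (k : ℕ) :
    (addBox eta i h).rowLen k = eta.rowLen k + if k = i then 1 else 0 := by
  refine eq_of_forall_lt_iff fun j => ?_
  rw [← YoungDiagram.mem_iff_lt_rowLen, ← YoungDiagram.mem_cells, addBox, Finset.mem_insert,
    YoungDiagram.mem_cells, YoungDiagram.mem_iff_lt_rowLen, Prod.mk.injEq]
  split_ifs with hk
  · subst hk; omega
  · omega

theorem rowLen_removeBox (h : Removable eta i) (k : ℕ) :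
    (removeBox eta i h).rowLen k = eta.rowLen k - if k = i then 1 else 0 := by
  refine eq_of_forall_lt_iff fun j => ?_
  rw [← YoungDiagram.mem_iff_lt_rowLen, ← YoungDiagram.mem_cells, removeBox, Finset.mem_erase,
    YoungDiagram.mem_cells, YoungDiagram.mem_iff_lt_rowLen, Ne, Prod.mk.injEq]
  split_ifs with hk
  · subst hk; omega
  · omega

/-- The column that receives the new box meets exactly the rows above `i`, since these are strictly
longer than row `i`. -/
theorem colLen_rowLen (h : Addable eta i) : eta.colLen (eta.rowLen i) = i := by
  refine eq_of_forall_lt_iff fun k => ?_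
  rw [← YoungDiagram.mem_iff_lt_colLen, YoungDiagram.mem_iff_lt_rowLen]
  refine ⟨fun hk => ?_, fun hk => h k hk⟩
  by_contra hik
  exact absurd (eta.rowLen_anti i k (by omega)) (by omega)

theorem colLen_addBox (h : Addable eta i) (j : ℕ) :
    (addBox eta i h).colLen j = eta.colLen j + if j = eta.rowLen i then 1 else 0 := by
  refine eq_of_forall_lt_iff fun k => ?_
  rw [← YoungDiagram.mem_iff_lt_colLen, ← YoungDiagram.mem_cells, addBox, Finset.mem_insert,
    YoungDiagram.mem_cells, YoungDiagram.mem_iff_lt_colLen, Prod.mk.injEq]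
  split_ifs with hk
  · subst hk
    rw [colLen_rowLen h]
    omega
  · simp [hk]

theorem card_addBox (h : Addable eta i) : (addBox eta i h).card = eta.card + 1 := by
  change (insert (i, eta.rowLen i) eta.cells).card = eta.cells.card + 1
  refine Finset.card_insert_of_notMem ?_
  rw [YoungDiagram.mem_cells, YoungDiagram.mem_iff_lt_rowLen]
  exact lt_irrefl _

theorem card_removeBox (h : Removable eta i) : (removeBox eta i h).card + 1 = eta.card := by
  change (eta.cells.erase (i, eta.rowLen i - 1)).card + 1 = eta.cells.card
  refine Finset.card_erase_add_one ?_
  rw [YoungDiagram.mem_cells, YoungDiagram.mem_iff_lt_rowLen]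
  have h' : eta.rowLen (i + 1) < eta.rowLen i := h
  omega

theorem removable_addBox (h : Addable eta i) : Removable (addBox eta i h) i := by
  have := eta.rowLen_anti i (i + 1) (by omega)
  simp only [Removable, rowLen_addBox]
  split_ifs <;> omega

theorem addable_removeBox (h : Removable eta i) : Addable (removeBox eta i h) i := by
  intro k hk
  have := eta.rowLen_anti k i hk.le
  have h' : eta.rowLen (i + 1) < eta.rowLen i := h
  simp only [rowLen_removeBox]
  split_ifs <;> omega

theorem eq_of_rowLen_eq {eta theta : YoungDiagram} (h : ∀ k, eta.rowLen k = theta.rowLen k) :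
    eta = theta := by
  apply YoungDiagram.ext
  ext ⟨a, b⟩
  rw [YoungDiagram.mem_cells, YoungDiagram.mem_cells, YoungDiagram.mem_iff_lt_rowLen,
    YoungDiagram.mem_iff_lt_rowLen, h]

theorem removeBox_addBox (h : Addable eta i) :
    removeBox (addBox eta i h) i (removable_addBox h) = eta :=
  eq_of_rowLen_eq fun k => by simp [rowLen_removeBox, rowLen_addBox]

theorem addBox_removeBox (h : Removable eta i) :
    addBox (removeBox eta i h) i (addable_removeBox h) = eta :=
  eq_of_rowLen_eq fun k => by
    have h' : eta.rowLen (i + 1) < eta.rowLen i := h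
    simp only [rowLen_removeBox, rowLen_addBox]
    split_ifs with hk
    · subst hk; omega
    · omega

theorem rowLen_eq_zero {k : ℕ} (h : eta.colLen 0 ≤ k) : eta.rowLen k = 0 := by
  by_contra h0
  have : (k, 0) ∈ eta := YoungDiagram.mem_iff_lt_rowLen.2 (by omega)
  rw [YoungDiagram.mem_iff_lt_colLen] at this
  omega

theorem colLen_zero_le_card (eta : YoungDiagram) : eta.colLen 0 ≤ eta.card := by
  rw [YoungDiagram.colLen_eq_card]
  exact Finset.card_le_card (Finset.filter_subset _ _)

open Classical in
/-- Summation by parts along the Young graph: if adding a box to row `i` turns the summand `f`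
into the summand `g`, then the sums over all diagrams agree. -/
theorem sum_addBox_eq_sum_removeBox {M : Type*} [AddCommMonoid M] (n i : ℕ)
    (f g : YoungDiagram → M) (hf : ∀ eta, eta.card = n → ¬ Addable eta i → f eta = 0)
    (hg : ∀ theta, theta.card = n + 1 → ¬ Removable theta i → g theta = 0)
    (hfg : ∀ eta, eta.card = n → ∀ h : Addable eta i, f eta = g (addBox eta i h)) :
    ∑ eta ∈ diagramsOfSize n, f eta = ∑ theta ∈ diagramsOfSize (n + 1), g theta := by
  rw [← Finset.sum_filter_of_ne (p := fun eta => Addable eta i)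
      (fun eta he hne => by_contra fun h => hne (hf eta (mem_diagramsOfSize.1 he) h)),
    ← Finset.sum_filter_of_ne (s := diagramsOfSize (n + 1)) (p := fun eta => Removable eta i)
      (fun eta he hne => by_contra fun h => hne (hg eta (mem_diagramsOfSize.1 he) h))]
  refine Finset.sum_bij' (fun eta he => addBox eta i (Finset.mem_filter.1 he).2)
    (fun theta ht => removeBox theta i (Finset.mem_filter.1 ht).2) ?_ ?_ ?_ ?_ ?_
  · intro eta he
    obtain ⟨h1, h2⟩ := Finset.mem_filter.1 he
    rw [mem_diagramsOfSize] at h1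
    exact Finset.mem_filter.2 ⟨mem_diagramsOfSize.2 (by rw [card_addBox, h1]),
      removable_addBox h2⟩
  · intro theta ht
    obtain ⟨h1, h2⟩ := Finset.mem_filter.1 ht
    rw [mem_diagramsOfSize] at h1
    have h3 := card_removeBox h2
    exact Finset.mem_filter.2 ⟨mem_diagramsOfSize.2 (by omega), addable_removeBox h2⟩
  · intro eta he
    exact removeBox_addBox _
  · intro theta ht
    exact addBox_removeBox _
  · intro eta he
    obtain ⟨h1, h2⟩ := Finset.mem_filter.1 he
    exact hfg eta (mem_diagramsOfSize.1 h1) h2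

/-- Columns `j ∈ [η_{m+1}, η_m)` are those of length `m + 1`. -/
theorem colLen_eq_of_rowLen {m j : ℕ} (h1 : eta.rowLen (m + 1) ≤ j) (h2 : j < eta.rowLen m) :
    eta.colLen j = m + 1 := by
  have h3 : m < eta.colLen j := by
    rwa [← YoungDiagram.mem_iff_lt_colLen, YoungDiagram.mem_iff_lt_rowLen]
  have h4 : ¬ m + 1 < eta.colLen j := by
    rw [← YoungDiagram.mem_iff_lt_colLen, YoungDiagram.mem_iff_lt_rowLen]
    omega
  omega

/-- Telescoping along row `i`, the columns being grouped by their lengths. -/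
theorem prod_row_telescope {K : Type*} [Field K] (eta : YoungDiagram) (u : ℕ → ℕ → K) {i N : ℕ}
    (hN : eta.colLen 0 ≤ N) (hi : i ≤ N)
    (hu : ∀ m j, i < m → j ≤ eta.rowLen i → u m j ≠ 0) :
    ∏ j ∈ Finset.range (eta.rowLen i), u (eta.colLen j) j / u (eta.colLen j) (j + 1)
      = ∏ m ∈ Finset.Ico i N, u (m + 1) (eta.rowLen (m + 1)) / u (m + 1) (eta.rowLen m) := by
  induction hi using Nat.decreasingInduction with
  | self => simp [rowLen_eq_zero hN]
  | of_succ k hk ih =>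
    have hle := eta.rowLen_anti k (k + 1) (by omega)
    rw [← Finset.prod_range_mul_prod_Ico _ hle,
      ih (fun m j hm hj => hu m j (by omega) (hj.trans hle)), Finset.prod_eq_prod_Ico_succ_bot hk,
      mul_comm]
    congr 1
    rw [Finset.prod_congr rfl (g := fun j => u (k + 1) j / u (k + 1) (j + 1))
      (fun j hj => by
        rw [Finset.mem_Ico] at hj
        rw [colLen_eq_of_rowLen hj.1 hj.2])]
    have aux : ∀ b, eta.rowLen (k + 1) ≤ b → b ≤ eta.rowLen k →
        ∏ j ∈ Finset.Ico (eta.rowLen (k + 1)) b, u (k + 1) j / u (k + 1) (j + 1)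
          = u (k + 1) (eta.rowLen (k + 1)) / u (k + 1) b := by
      intro b hb
      induction b, hb using Nat.le_induction with
      | base => intro hb; simp [div_self (hu (k + 1) _ (by omega) hb)]
      | succ b hb ih =>
        intro hb'
        rw [Finset.prod_Ico_succ_top hb, ih (by omega), div_mul_div_cancel₀]
        exact hu (k + 1) b (by omega) (by omega)
    exact aux _ hle le_rfl

end Diagrams

/-! ### Detailed balance of the hook weights -/

section Weights

variable {K : Type*} [Field K]

/-- The row variable `q^{η_i} t^{1/2 - i}`, with rows numbered from `0`. -/
def rowVar (q τ : K) (eta : YoungDiagram) (i : ℕ) : K :=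
  q ^ eta.rowLen i * τ ^ (-(2 * (i : ℤ) + 1))

/-- The coefficient of the box in row `i` for adding boxes; it vanishes if no box can be added. -/
def upCoeff (q τ : K) (eta : YoungDiagram) (N i : ℕ) : K :=
  (∏ j ∈ Finset.range N, (1 - rowVar q τ eta j / (τ ^ 2 * rowVar q τ eta i))) /
    ∏ j ∈ (Finset.range (N + 1)).erase i, (1 - rowVar q τ eta j / rowVar q τ eta i)

/-- The coefficient of the box in row `i` for removing boxes; it vanishes if no box can be
removed. -/
def downCoeff (q τ : K) (eta : YoungDiagram) (N i : ℕ) : K :=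
  rowVar q τ eta i * τ⁻¹ *
    (∏ j ∈ Finset.range (N + 1), (1 - τ ^ 2 * rowVar q τ eta j / rowVar q τ eta i)) /
    ∏ j ∈ (Finset.range N).erase i, (1 - rowVar q τ eta j / rowVar q τ eta i)

/-- The hook factor of a box. -/
def hookFactor (q τ : K) (eta : YoungDiagram) (c : ℕ × ℕ) : K :=
  (1 - q ^ ((eta.rowLen c.1 : ℤ) - (c.2 : ℤ))
      * (τ ^ 2) ^ ((eta.colLen c.2 : ℤ) - (c.1 : ℤ) - 1))
    * (1 - q ^ (-(eta.rowLen c.1 : ℤ) + (c.2 : ℤ) + 1)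
      * (τ ^ 2) ^ (-(eta.colLen c.2 : ℤ) + (c.1 : ℤ)))

theorem boxWeight_eq (q τ : K) (eta : YoungDiagram) :
    boxWeight q τ eta = (∏ c ∈ eta.cells, hookFactor q τ eta c)⁻¹ := by
  rw [boxWeight, ← Finset.prod_inv_distrib]
  exact Finset.prod_congr rfl fun c _ => by rw [one_div, hookFactor]

/-- `q ^ m * t ^ n ≠ 1` for all natural exponents, not both zero. -/
def Generic (q τ : K) : Prop := ∀ m n : ℕ, (m, n) ≠ (0, 0) → q ^ m * (τ ^ 2) ^ n ≠ 1

variable {q τ : K} {eta : YoungDiagram} {i N : ℕ}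

theorem Generic.zpow_ne (hgen : Generic q τ) {a b : ℤ}
    (h : 0 ≤ a ∧ 0 < b ∨ 0 < a ∧ 0 ≤ b) : q ^ a * (τ ^ 2) ^ b ≠ 1 := by
  lift a to ℕ using by omega
  lift b to ℕ using by omega
  rw [zpow_natCast, zpow_natCast]
  refine hgen a b ?_
  rw [Ne, Prod.mk.injEq]
  omega

theorem Generic.zpow_ne_of_neg (hgen : Generic q τ) {a b : ℤ}
    (h : a ≤ 0 ∧ b < 0 ∨ a < 0 ∧ b ≤ 0) : q ^ a * (τ ^ 2) ^ b ≠ 1 := by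
  have h1 := hgen.zpow_ne (a := -a) (b := -b) (by omega)
  contrapose! h1
  rw [zpow_neg, zpow_neg, ← mul_inv, h1, inv_one]

/-- Exponents weakly of one sign and not both zero: this covers hook factors as well as ratios of
distinct row variables. Nonpositive pairs reduce to nonnegative ones by inversion. -/
theorem Generic.one_sub_ne (hgen : Generic q τ) {a b : ℤ}
    (h : 0 ≤ a ∧ 0 < b ∨ 0 < a ∧ 0 ≤ b ∨ a ≤ 0 ∧ b < 0 ∨ a < 0 ∧ b ≤ 0) :
    1 - q ^ a * (τ ^ 2) ^ b ≠ 0 := by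
  rw [sub_ne_zero]
  refine Ne.symm ?_
  by_cases h1 : 0 ≤ a ∧ 0 < b ∨ 0 < a ∧ 0 ≤ b
  · exact hgen.zpow_ne h1
  · exact hgen.zpow_ne_of_neg (by omega)

theorem rowVar_ne_zero (hq : q ≠ 0) (hτ : τ ≠ 0) (eta : YoungDiagram) (i : ℕ) :
    rowVar q τ eta i ≠ 0 :=
  mul_ne_zero (pow_ne_zero _ hq) (zpow_ne_zero _ hτ)

theorem rowVar_div (hq : q ≠ 0) (hτ : τ ≠ 0) (eta : YoungDiagram) (i j : ℕ) :
    rowVar q τ eta j / rowVar q τ eta i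
      = q ^ ((eta.rowLen j : ℤ) - eta.rowLen i) * (τ ^ 2) ^ ((i : ℤ) - j) := by
  rw [rowVar, rowVar, zpow_sub₀ hq, mul_div_mul_comm, zpow_natCast, zpow_natCast, ← zpow_sub₀ hτ,
    ← zpow_natCast τ 2, ← zpow_mul]
  congr 2
  push_cast
  ring

theorem Generic.one_sub_rowVar_div_ne (hgen : Generic q τ) (hq : q ≠ 0) (hτ : τ ≠ 0)
    (eta : YoungDiagram) {i j : ℕ} (hij : j ≠ i) :
    1 - rowVar q τ eta j / rowVar q τ eta i ≠ 0 := by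
  rw [rowVar_div hq hτ]
  apply hgen.one_sub_ne
  rcases hij.lt_or_gt with h | h
  · have := eta.rowLen_anti j i h.le
    omega
  · have := eta.rowLen_anti i j h.le
    omega

theorem hookFactor_ne_zero (hgen : Generic q τ) {c : ℕ × ℕ} (hc : c ∈ eta.cells) :
    hookFactor q τ eta c ≠ 0 := by
  have h1 : c.1 < eta.colLen c.2 := YoungDiagram.mem_iff_lt_colLen.1 hc
  have h2 : c.2 < eta.rowLen c.1 := YoungDiagram.mem_iff_lt_rowLen.1 hc
  exact mul_ne_zero (hgen.one_sub_ne (by omega)) (hgen.one_sub_ne (by omega))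

theorem rowVar_addBox_self (h : Addable eta i) :
    rowVar q τ (addBox eta i h) i = q * rowVar q τ eta i := by
  rw [rowVar, rowVar, rowLen_addBox, if_pos rfl, pow_succ]
  ring

theorem rowVar_addBox_of_ne (h : Addable eta i) {j : ℕ} (hj : j ≠ i) :
    rowVar q τ (addBox eta i h) j = rowVar q τ eta j := by
  rw [rowVar, rowVar, rowLen_addBox, if_neg hj, add_zero]

/-- Only hooks in row `i` and in the column of the new box change. In the row the ratios telescope
over columns of equal length; in the column each row above `i` contributes one factor directly. -/
theorem prod_hookFactor_addBox (hgen : Generic q τ) (hq : q ≠ 0) (hτ : τ ≠ 0)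
    (h : Addable eta i) (hN : (addBox eta i h).colLen 0 ≤ N) :
    (∏ c ∈ (addBox eta i h).cells, hookFactor q τ (addBox eta i h) c) /
        ∏ c ∈ eta.cells, hookFactor q τ eta c
      = (∏ j ∈ (Finset.range (N + 1)).erase i,
          (1 - rowVar q τ eta j / rowVar q τ eta i)
            * (1 - q * rowVar q τ eta i / (τ ^ 2 * rowVar q τ eta j))) /
        ∏ j ∈ (Finset.range N).erase i,
          (1 - rowVar q τ eta j / (τ ^ 2 * rowVar q τ eta i))
            * (1 - q * rowVar q τ eta i / rowVar q τ eta j) := by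
  set c := eta.rowLen i with hc
  set x := rowVar q τ eta with hx
  set f : ℕ → K := fun j => (1 - x j / x i) * (1 - q * x i / (τ ^ 2 * x j)) with hf
  set g : ℕ → K := fun j => (1 - x j / (τ ^ 2 * x i)) * (1 - q * x i / x j) with hg
  have hT : τ ^ 2 ≠ 0 := pow_ne_zero _ hτ
  have hiN : i < N := by
    refine lt_of_lt_of_le ?_ hN
    rw [← YoungDiagram.mem_iff_lt_colLen, YoungDiagram.mem_iff_lt_rowLen, rowLen_addBox, if_pos rfl]
    omega
  have hN' : eta.colLen 0 ≤ N := by rw [colLen_addBox] at hN; omega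
  have hr (j : ℕ) : x j / x i = q ^ ((eta.rowLen j : ℤ) - c) * (τ ^ 2) ^ ((i : ℤ) - j) :=
    rowVar_div hq hτ eta i j
  have hr' (j : ℕ) : x j / (τ ^ 2 * x i)
      = q ^ ((eta.rowLen j : ℤ) - c) * (τ ^ 2) ^ ((i : ℤ) - j - 1) := by
    rw [mul_comm, ← div_div, hr, zpow_sub_one₀ hT]
    ring
  have hs (j : ℕ) : q * x i / x j
      = q ^ (-(eta.rowLen j : ℤ) + c + 1) * (τ ^ 2) ^ ((j : ℤ) - i) := by
    rw [mul_div_assoc, rowVar_div hq hτ eta j i, ← mul_assoc, ← zpow_one_add₀ hq]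
    congr 2; ring
  have hs' (j : ℕ) : q * x i / (τ ^ 2 * x j)
      = q ^ (-(eta.rowLen j : ℤ) + c + 1) * (τ ^ 2) ^ ((j : ℤ) - i - 1) := by
    rw [mul_comm (τ ^ 2), ← div_div, hs, zpow_sub_one₀ hT]
    ring
  set theta := addBox eta i h with hθ
  have hcells : theta.cells = insert (i, c) eta.cells := rfl
  have hnot : (i, c) ∉ eta.cells := by
    rw [YoungDiagram.mem_cells, YoungDiagram.mem_iff_lt_rowLen]; exact lt_irrefl _
  have hnew : hookFactor q τ theta (i, c) = g i := by
    simp only [hookFactor, hg, hr', hs, hθ, rowLen_addBox, colLen_addBox, ← hc, if_true]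
    rw [hc, colLen_rowLen h]
    refine (mul_comm _ _).trans ?_
    push_cast
    congr 2 <;> congr 2 <;> ring_nf
  -- For a box (i, j) in a column of length m, `u m j` is the hook factor after the addition and `u
  -- m (j + 1)` the one before it.
  let u : ℕ → ℕ → K := fun m j => (1 - q ^ ((c : ℤ) + 1 - j) * (τ ^ 2) ^ ((m : ℤ) - i - 1)) *
    (1 - q ^ ((j : ℤ) - c) * (τ ^ 2) ^ ((i : ℤ) - m))
  have hrow : ∏ j ∈ Finset.range c, hookFactor q τ theta (i, j) / hookFactor q τ eta (i, j)
      = (∏ j ∈ Finset.Ico (i + 1) (N + 1), f j) / ∏ j ∈ Finset.Ico i N, g j := by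
    have h1 := prod_row_telescope eta u hN' hiN.le (fun m j hm hj =>
      mul_ne_zero (hgen.one_sub_ne (by omega)) (hgen.one_sub_ne (by omega)))
    rw [← Finset.prod_Ico_add' f, ← Finset.prod_div_distrib]
    refine Eq.trans (Finset.prod_congr rfl fun j hj => ?_)
      (h1.trans (Finset.prod_congr rfl fun m _ => ?_))
    · have hj' := Finset.mem_range.1 hj
      simp only [hookFactor, u, hθ, rowLen_addBox, colLen_addBox, ← hc, if_true, if_neg hj'.ne,
        add_zero]
      push_cast
      congr 2 <;> congr 2 <;> congr 1 <;> ring_nf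
    · simp only [u, hf, hg, hr, hr', hs, hs']
      rw [mul_comm, mul_comm (1 - q ^ ((c : ℤ) + 1 - eta.rowLen m) * _)]
      push_cast
      congr 2 <;> congr 2 <;> congr 1 <;> ring_nf
  have hcol : ∏ k ∈ Finset.range i, hookFactor q τ theta (k, c) / hookFactor q τ eta (k, c)
      = (∏ j ∈ Finset.range i, f j) / ∏ j ∈ Finset.range i, g j := by
    rw [← Finset.prod_div_distrib]
    refine Finset.prod_congr rfl fun k hk => ?_
    have hk' := Finset.mem_range.1 hk
    simp only [hookFactor, hf, hg, hr, hr', hs, hs', hθ, rowLen_addBox, colLen_addBox, ← hc,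
      if_true, if_neg hk'.ne, add_zero]
    rw [hc, colLen_rowLen h]
    push_cast
    congr 2 <;> congr 2 <;> congr 1 <;> ring_nf
  have hold : ∏ d ∈ eta.cells, hookFactor q τ theta d / hookFactor q τ eta d
      = (∏ j ∈ Finset.range c, hookFactor q τ theta (i, j) / hookFactor q τ eta (i, j)) *
        ∏ k ∈ Finset.range i, hookFactor q τ theta (k, c) / hookFactor q τ eta (k, c) := by
    rw [← Finset.prod_image (s := Finset.range c) (g := fun j => (i, j))
        (f := fun d => hookFactor q τ theta d / hookFactor q τ eta d) (by simp [Set.InjOn]),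
      ← Finset.prod_image (s := Finset.range i) (g := fun k => (k, c))
        (f := fun d => hookFactor q τ theta d / hookFactor q τ eta d) (by simp [Set.InjOn]),
      ← Finset.prod_union]
    · symm
      refine Finset.prod_subset ?_ ?_
      · intro d hd
        simp only [Finset.mem_union, Finset.mem_image, Finset.mem_range] at hd
        rw [YoungDiagram.mem_cells]
        rcases hd with ⟨j, hj, rfl⟩ | ⟨k, hk, rfl⟩
        · exact YoungDiagram.mem_iff_lt_rowLen.2 hj
        · exact YoungDiagram.mem_iff_lt_rowLen.2 (h k hk)
      · rintro ⟨a, b⟩ hd hd'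
        have hab := YoungDiagram.mem_iff_lt_rowLen.1 ((YoungDiagram.mem_cells _).1 hd)
        simp only [Finset.mem_union, Finset.mem_image, Finset.mem_range, Prod.mk.injEq,
          not_or, not_exists, not_and] at hd'
        have ha : a ≠ i := fun hai => hd'.1 b (by rw [hc, ← hai]; exact hab) hai.symm rfl
        have hb : b ≠ c := fun hbc => by
          refine hd'.2 a ?_ rfl hbc.symm
          rw [← colLen_rowLen h, ← hc, ← hbc, ← YoungDiagram.mem_iff_lt_colLen]
          exact (YoungDiagram.mem_cells _).1 hd
        have : hookFactor q τ theta (a, b) = hookFactor q τ eta (a, b) := by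
          simp only [hookFactor, hθ, rowLen_addBox, colLen_addBox, ← hc, if_neg ha, if_neg hb,
            add_zero]
        rw [this, div_self (hookFactor_ne_zero hgen hd)]
    · rw [Finset.disjoint_left]
      rintro ⟨a, b⟩ h1 h2
      simp only [Finset.mem_image, Finset.mem_range, Prod.mk.injEq] at h1 h2
      obtain ⟨_, hj, -, rfl⟩ := h1
      obtain ⟨_, _, -, h3⟩ := h2
      omega
  -- The hook factor of the new box is `g i`, which cancels the term of index `i` in the denominator
  -- of the row product; hence both final products omit `i`.
  have hgi : g i ≠ 0 := by
    rw [← hnew]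
    exact hookFactor_ne_zero hgen (by rw [hcells]; exact Finset.mem_insert_self _ _)
  rw [hcells, Finset.prod_insert hnot, mul_div_assoc, ← Finset.prod_div_distrib, hold, hrow, hcol,
    hnew]
  have he1 : (Finset.range (N + 1)).erase i = Finset.range i ∪ Finset.Ico (i + 1) (N + 1) := by
    ext j; simp; omega
  have he2 : (Finset.range N).erase i = Finset.range i ∪ Finset.Ico (i + 1) N := by
    ext j; simp; omega
  have hd : ∀ M, Disjoint (Finset.range i) (Finset.Ico (i + 1) M) := fun M => by
    rw [Finset.disjoint_left]; intro j; simp; omega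
  rw [he1, he2, Finset.prod_union (hd _), Finset.prod_union (hd _),
    Finset.prod_eq_prod_Ico_succ_bot hiN]
  change _ = (∏ j ∈ Finset.range i, f j) * (∏ j ∈ Finset.Ico (i + 1) (N + 1), f j) /
    ((∏ j ∈ Finset.range i, g j) * ∏ j ∈ Finset.Ico (i + 1) N, g j)
  rw [mul_comm (∏ j ∈ Finset.range i, f j), div_mul_div_comm, mul_div_assoc', mul_assoc (g i),
    mul_comm (∏ j ∈ Finset.range i, g j), mul_div_mul_left _ _ hgi]

theorem rowVar_of_colLen_le (hN : eta.colLen 0 ≤ N) :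
    rowVar q τ eta N = τ ^ (-(2 * (N : ℤ) + 1)) := by
  rw [rowVar, rowLen_eq_zero hN, pow_zero, one_mul]

/-- The weights of two diagrams that differ by a box. -/
theorem boxWeight_mul_upCoeff (hgen : Generic q τ) (hq : q ≠ 0) (hτ : τ ≠ 0)
    (h : Addable eta i) (hN : (addBox eta i h).colLen 0 ≤ N) :
    boxWeight q τ eta * upCoeff q τ eta N i
      = boxWeight q τ (addBox eta i h) * downCoeff q τ (addBox eta i h) N i := by
  have hT : τ ^ 2 ≠ 0 := pow_ne_zero _ hτ
  have hiN : i < N := by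
    refine lt_of_lt_of_le ?_ hN
    rw [← YoungDiagram.mem_iff_lt_colLen, YoungDiagram.mem_iff_lt_rowLen, rowLen_addBox, if_pos rfl]
    omega
  have hN' : eta.colLen 0 ≤ N := by rw [colLen_addBox] at hN; omega
  have hprod := prod_hookFactor_addBox hgen hq hτ h hN
  have hV : ∏ c ∈ eta.cells, hookFactor q τ eta c ≠ 0 :=
    Finset.prod_ne_zero_iff.2 fun c hc => hookFactor_ne_zero hgen hc
  have hV' : ∏ c ∈ (addBox eta i h).cells, hookFactor q τ (addBox eta i h) c ≠ 0 :=
    Finset.prod_ne_zero_iff.2 fun c hc => hookFactor_ne_zero hgen hc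
  have hx0 := rowVar_ne_zero hq hτ eta
  have hdist : ∀ j, j ≠ i → 1 - rowVar q τ eta j / rowVar q τ eta i ≠ 0 :=
    fun j hj => hgen.one_sub_rowVar_div_ne hq hτ eta hj
  have hdist' : ∀ j, j ≠ i → 1 - rowVar q τ eta j / (q * rowVar q τ eta i) ≠ 0 := fun j hj => by
    have := hgen.one_sub_rowVar_div_ne hq hτ (addBox eta i h) hj
    rwa [rowVar_addBox_self, rowVar_addBox_of_ne h hj] at this
  have hxN := rowVar_of_colLen_le (q := q) (τ := τ) hN'
  rw [boxWeight_eq, boxWeight_eq, downCoeff, rowVar_addBox_self, upCoeff]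
  set x := rowVar q τ eta with hx
  have e1 : ∏ j ∈ Finset.range (N + 1),
      (1 - τ ^ 2 * rowVar q τ (addBox eta i h) j / (q * x i))
      = (1 - τ ^ 2) * (1 - τ ^ 2 * x N / (q * x i)) *
        ∏ j ∈ (Finset.range N).erase i, (1 - τ ^ 2 * x j / (q * x i)) := by
    rw [Finset.prod_range_succ, ← Finset.mul_prod_erase _ _ (Finset.mem_range.2 hiN),
      rowVar_addBox_self, rowVar_addBox_of_ne h hiN.ne', mul_div_assoc,
      div_self (mul_ne_zero hq (hx0 i)), mul_one,
      Finset.prod_congr rfl fun j hj => by rw [rowVar_addBox_of_ne h (Finset.ne_of_mem_erase hj)]]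
    ring
  have e2 : ∏ j ∈ (Finset.range N).erase i, (1 - rowVar q τ (addBox eta i h) j / (q * x i))
      = ∏ j ∈ (Finset.range N).erase i, (1 - x j / (q * x i)) :=
    Finset.prod_congr rfl fun j hj => by rw [rowVar_addBox_of_ne h (Finset.ne_of_mem_erase hj)]
  have e3 : ∏ j ∈ Finset.range N, (1 - x j / (τ ^ 2 * x i))
      = (1 - (τ ^ 2)⁻¹) * ∏ j ∈ (Finset.range N).erase i, (1 - x j / (τ ^ 2 * x i)) := by
    rw [← Finset.mul_prod_erase _ _ (Finset.mem_range.2 hiN)]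
    congr 2
    have := hx0 i
    field_simp
  have e4 : (Finset.range (N + 1)).erase i = insert N ((Finset.range N).erase i) := by
    ext j; simp; omega
  have hNmem : N ∉ (Finset.range N).erase i := by simp
  -- Use 1 - y = -y(1 - y⁻¹) in each factor: the monomials cancel except for one t⁻¹ for each of the
  -- N - 1 rows.
  have e5 : (∏ j ∈ (Finset.range N).erase i, (1 - q * x i / (τ ^ 2 * x j))) *
        ∏ j ∈ (Finset.range N).erase i, (1 - x j / (q * x i))
      = ((τ ^ 2)⁻¹) ^ (N - 1) * (∏ j ∈ (Finset.range N).erase i, (1 - τ ^ 2 * x j / (q * x i))) *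
        ∏ j ∈ (Finset.range N).erase i, (1 - q * x i / x j) := by
    have hcard : ((Finset.range N).erase i).card = N - 1 := by
      rw [Finset.card_erase_of_mem (Finset.mem_range.2 hiN), Finset.card_range]
    rw [← hcard, ← Finset.prod_const, ← Finset.prod_mul_distrib, ← Finset.prod_mul_distrib,
      ← Finset.prod_mul_distrib]
    refine Finset.prod_congr rfl fun j _ => ?_
    have h1 := hx0 i
    have h2 := hx0 j
    field_simp
    ring
  have hs1 : ∏ j ∈ (Finset.range N).erase i, (1 - x j / (q * x i)) ≠ 0 :=
    Finset.prod_ne_zero_iff.2 fun j hj => hdist' j (Finset.ne_of_mem_erase hj)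
  have hs2 : ∏ j ∈ (Finset.range N).erase i, (1 - x j / x i) ≠ 0 :=
    Finset.prod_ne_zero_iff.2 fun j hj => hdist j (Finset.ne_of_mem_erase hj)
  have hs3 : ∏ j ∈ (Finset.range N).erase i,
      ((1 - x j / (τ ^ 2 * x i)) * (1 - q * x i / x j)) ≠ 0 := by
    intro h0
    rw [h0, div_zero] at hprod
    exact div_ne_zero hV' hV hprod
  rw [e4, Finset.prod_insert hNmem, Finset.prod_mul_distrib, Finset.prod_mul_distrib] at hprod
  rw [Finset.prod_mul_distrib] at hs3
  rw [e1, e2, e3, e4, Finset.prod_insert hNmem]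
  have hN0 := hdist N hiN.ne'
  -- The leftover power of t is absorbed by the first empty row, x_N = τ^{-(2N+1)}. This fixes the
  -- factor `τ⁻¹` in `downCoeff` and makes the balance independent of the cutoff.
  have hscal : ((τ ^ 2)⁻¹) ^ (N - 1) = τ ^ 2 * τ * x N := by
    rw [hxN, ← zpow_natCast τ 2, ← zpow_neg, ← zpow_natCast, ← zpow_mul, mul_assoc,
      ← zpow_one_add₀ hτ, ← zpow_add₀ hτ]
    congr 1
    push_cast [show ((N - 1 : ℕ) : ℤ) = (N : ℤ) - 1 by omega]
    ring
  rw [hscal] at e5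
  have hxi := hx0 i
  have hxN0 := hx0 N
  generalize ∏ j ∈ (Finset.range N).erase i, (1 - x j / (q * x i)) = P4 at *
  generalize ∏ j ∈ (Finset.range N).erase i, (1 - x j / x i) = P2 at *
  generalize ∏ j ∈ (Finset.range N).erase i, (1 - x j / (τ ^ 2 * x i)) = P1 at *
  generalize ∏ j ∈ (Finset.range N).erase i, (1 - q * x i / x j) = P6 at *
  generalize ∏ j ∈ (Finset.range N).erase i, (1 - τ ^ 2 * x j / (q * x i)) = P3 at *
  generalize ∏ j ∈ (Finset.range N).erase i, (1 - q * x i / (τ ^ 2 * x j)) = P5 at *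
  obtain ⟨hP1, hP6⟩ := mul_ne_zero_iff.1 hs3
  have hVinv : (∏ c ∈ eta.cells, hookFactor q τ eta c)⁻¹
      = (∏ c ∈ (addBox eta i h).cells, hookFactor q τ (addBox eta i h) c)⁻¹ *
        ((1 - x N / x i) * P2 * ((1 - q * x i / (τ ^ 2 * x N)) * P5) / (P1 * P6)) := by
    rw [mul_mul_mul_comm, ← hprod]
    field_simp
  have hquot : P5 / P6 = τ ^ 2 * τ * x N * P3 / P4 := by
    rw [div_eq_div_iff hP6 hs1, e5]
  rw [hVinv, mul_assoc]
  congr 1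
  calc _ = (1 - q * x i / (τ ^ 2 * x N)) * (1 - (τ ^ 2)⁻¹) * (P5 / P6) := by
        generalize 1 - x N / x i = a at *
        generalize 1 - q * x i / (τ ^ 2 * x N) = b
        field_simp
    _ = q * x i * τ⁻¹ * ((1 - τ ^ 2) * (1 - τ ^ 2 * x N / (q * x i))) * (P3 / P4) := by
        rw [hquot]
        field_simp
        ring
    _ = _ := by ring

/-- Rows i - 1 and i then have equal length, so x_{i-1} = t x_i and a numerator factor vanishes. -/
theorem upCoeff_eq_zero (hq : q ≠ 0) (hτ : τ ≠ 0) (hi : i ≤ N)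
    (h : ¬ Addable eta i) : upCoeff q τ eta N i = 0 := by
  obtain ⟨k, hk, hki⟩ : ∃ k < i, eta.rowLen k ≤ eta.rowLen i := by
    simpa [Addable] using h
  have hx0 := rowVar_ne_zero hq hτ eta i
  have hi1 : i - 1 + 1 = i := by omega
  have hlen : eta.rowLen (i - 1) = eta.rowLen i :=
    le_antisymm ((eta.rowLen_anti k (i - 1) (by omega)).trans hki)
      (eta.rowLen_anti (i - 1) i (by omega))
  rw [upCoeff, Finset.prod_eq_zero (i := i - 1) (Finset.mem_range.2 (by omega)), zero_div]
  have : rowVar q τ eta (i - 1) = τ ^ 2 * rowVar q τ eta i := by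
    rw [rowVar, rowVar, hlen, mul_left_comm, ← zpow_natCast τ 2, ← zpow_add₀ hτ]
    congr 2
    push_cast [show ((i - 1 : ℕ) : ℤ) = (i : ℤ) - 1 by omega]
    ring
  rw [this, div_self (mul_ne_zero (pow_ne_zero _ hτ) hx0), sub_self]

/-- Here t x_{i+1} = x_i. The numerator of `downCoeff` includes the index N so that this also covers
i = N - 1. -/
theorem downCoeff_eq_zero (hq : q ≠ 0) (hτ : τ ≠ 0) (hi : i < N)
    (h : ¬ Removable eta i) : downCoeff q τ eta N i = 0 := by
  have hlen : eta.rowLen (i + 1) = eta.rowLen i :=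
    le_antisymm (eta.rowLen_anti _ _ (by omega)) (not_lt.1 h)
  rw [downCoeff, Finset.prod_eq_zero (i := i + 1) (Finset.mem_range.2 (by omega)), mul_zero,
    zero_div]
  have : τ ^ 2 * rowVar q τ eta (i + 1) = rowVar q τ eta i := by
    rw [rowVar, rowVar, hlen, mul_left_comm, ← zpow_natCast τ 2, ← zpow_add₀ hτ]
    push_cast
    ring_nf
  rw [this, div_self (rowVar_ne_zero hq hτ eta i), sub_self]

end Weights

/-! ### Partial fractions of the rescaled row series -/

section PartialFractions

variable {K : Type*} [Field K]

theorem natDegree_one_sub_C_mul_X_le (a : K) :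
    (1 - Polynomial.C a * Polynomial.X : K[X]).natDegree ≤ 1 := by
  compute_degree

theorem natDegree_prod_one_sub_le {ι : Type*} (s : Finset ι) (x : ι → K) :
    (∏ j ∈ s, (1 - Polynomial.C (x j) * Polynomial.X)).natDegree ≤ s.card := by
  refine (Polynomial.natDegree_prod_le _ _).trans ?_
  refine (Finset.sum_le_sum fun j _ => natDegree_one_sub_C_mul_X_le (x j)).trans ?_
  simp

theorem coeff_card_prod_one_sub {ι : Type*} (s : Finset ι) (x : ι → K) :
    (∏ j ∈ s, (1 - Polynomial.C (x j) * Polynomial.X)).coeff s.card = ∏ j ∈ s, -x j := by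
  have h := Polynomial.coeff_prod_of_natDegree_le (s := s)
    (fun j => 1 - Polynomial.C (x j) * Polynomial.X) 1
    (fun j _ => natDegree_one_sub_C_mul_X_le (x j))
  rw [mul_one] at h
  rw [h]
  exact Finset.prod_congr rfl fun j _ => by simp [Polynomial.coeff_one]

/-- Lagrange interpolation at the points `1 / x_i`. -/
theorem eq_sum_prod_one_sub {ι : Type*} [DecidableEq ι] {s : Finset ι} {x : ι → K}
    (hx : ∀ i ∈ s, x i ≠ 0) (hinj : ∀ i ∈ s, ∀ j ∈ s, j ≠ i → 1 - x j / x i ≠ 0) {P : K[X]}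
    (hP : P.degree < s.card) :
    P = ∑ i ∈ s, Polynomial.C (P.eval (x i)⁻¹ / ∏ j ∈ s.erase i, (1 - x j / x i)) *
      ∏ j ∈ s.erase i, (1 - Polynomial.C (x j) * Polynomial.X) := by
  have hv : Set.InjOn (fun i => (x i)⁻¹) s := by
    intro i hi j hj hij
    by_contra hne
    have hij' : x i = x j := inv_injective hij
    refine hinj i hi j hj (Ne.symm hne) ?_
    rw [hij', div_self (hx j hj), sub_self]
  refine Polynomial.eq_of_degrees_lt_of_eval_index_eq s hv hP ?_ ?_
  · refine (Polynomial.degree_sum_le _ _).trans_lt ?_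
    rw [Finset.sup_lt_iff (WithBot.bot_lt_coe _)]
    intro i hi
    refine Polynomial.degree_le_natDegree.trans_lt ?_
    have h1 := (Polynomial.natDegree_C_mul_le
      (P.eval (x i)⁻¹ / ∏ j ∈ s.erase i, (1 - x j / x i)) _).trans
      (natDegree_prod_one_sub_le (s.erase i) x)
    have h2 := Finset.card_erase_lt_of_mem hi
    exact_mod_cast h1.trans_lt h2
  · intro k hk
    rw [Polynomial.eval_finsetSum, Finset.sum_eq_single_of_mem k hk]
    · rw [Polynomial.eval_mul, Polynomial.eval_C, Polynomial.eval_prod]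
      simp only [Polynomial.eval_sub, Polynomial.eval_one, Polynomial.eval_mul, Polynomial.eval_C,
        Polynomial.eval_X, ← div_eq_mul_inv]
      rw [div_mul_cancel₀]
      exact Finset.prod_ne_zero_iff.2 fun j hj =>
        hinj k hk j (Finset.mem_of_mem_erase hj) (Finset.ne_of_mem_erase hj)
    · intro i hi hik
      rw [Polynomial.eval_mul, Polynomial.eval_prod]
      refine mul_eq_zero_of_right _ (Finset.prod_eq_zero (Finset.mem_erase.2 ⟨hik.symm, hk⟩) ?_)
      simp [hx k hk]

variable {q τ : K} {eta : YoungDiagram} {N : ℕ}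

/-- Empty rows contribute zero to the finite sum, so any cutoff beyond the length is allowed, with
the last term standing for the full alphabet of the empty diagram. -/
theorem powerSumSpec_eq (hN : eta.colLen 0 ≤ N) (n : ℕ) :
    powerSumSpec q τ eta n
      = ∑ i ∈ Finset.range N, rowVar q τ eta i ^ n
        - ∑ i ∈ Finset.range N, rowVar q τ ⊥ i ^ n + 1 / (τ ^ n - (τ ^ n)⁻¹) := by
  rw [powerSumSpec, ← Finset.sum_sub_distrib]
  congr 1
  have h0 : ∀ i, (⊥ : YoungDiagram).rowLen i = 0 := fun i => rowLen_eq_zero (by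
    by_contra h
    exact YoungDiagram.notMem_bot _ (YoungDiagram.mem_iff_lt_colLen.2 (not_le.1 h)))
  have key : ∀ i, (q ^ (n * eta.rowLen i) - 1) * τ ^ (-((n : ℤ) * (2 * (i : ℤ) + 1)))
      = rowVar q τ eta i ^ n - rowVar q τ ⊥ i ^ n := fun i => by
    rw [rowVar, rowVar, h0, pow_zero, one_mul, mul_pow, ← pow_mul, ← zpow_natCast, ← zpow_natCast,
      ← zpow_natCast, ← zpow_mul, mul_comm (eta.rowLen i) n,
      show -(2 * (i : ℤ) + 1) * n = -(n * (2 * i + 1)) by ring]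
    ring
  rw [Finset.sum_congr rfl fun i _ => key i]
  refine Finset.sum_subset (Finset.range_mono hN) fun i _ hi => ?_
  rw [← key, rowLen_eq_zero (by simpa using hi)]
  simp

/-- Formally the constant is ∑_{i ≥ 0} τ^{-(n+1)(2i+1)}, and scaling by t prepends the term τ^{n+1}.
-/
theorem sq_pow_mul_const (hτ : τ ≠ 0) (hgen : Generic q τ) (n : ℕ) :
    (τ ^ 2) ^ (n + 1) * (1 / (τ ^ (n + 1) - (τ ^ (n + 1))⁻¹))
      = 1 / (τ ^ (n + 1) - (τ ^ (n + 1))⁻¹) + τ ^ (n + 1) := by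
  have h1 : (τ ^ 2) ^ (n + 1) - 1 ≠ 0 := by
    have := hgen 0 (n + 1) (by simp)
    rw [pow_zero, one_mul] at this
    rwa [sub_ne_zero]
  rw [← pow_mul, mul_comm 2, pow_mul] at h1 ⊢
  have h2 := pow_ne_zero (n + 1) hτ
  generalize τ ^ (n + 1) = a at *
  have h3 : a - a⁻¹ ≠ 0 := by
    intro h
    apply h1
    field_simp at h
    simpa using h
  field_simp
  ring

/-- Scaling by t carries the tail of rows from N + 1 on to the tail from N on; therefore N variables
are taken away and N + 1 scaled ones are put back. -/
theorem sq_pow_mul_powerSumSpec (hτ : τ ≠ 0) (hgen : Generic q τ) (hN : eta.colLen 0 ≤ N)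
    (n : ℕ) :
    (τ ^ 2) ^ (n + 1) * powerSumSpec q τ eta (n + 1)
      = powerSumSpec q τ eta (n + 1) - ∑ i ∈ Finset.range N, rowVar q τ eta i ^ (n + 1)
        + ∑ i ∈ Finset.range (N + 1), (τ ^ 2 * rowVar q τ eta i) ^ (n + 1) := by
  have hbot : ∀ i, rowVar q τ ⊥ i = τ ^ (-(2 * (i : ℤ) + 1)) := fun i => by
    refine rowVar_of_colLen_le ?_
    by_contra h
    exact YoungDiagram.notMem_bot _ (YoungDiagram.mem_iff_lt_colLen.2 (not_le.1 h))
  have hstep : ∀ i, τ ^ 2 * rowVar q τ ⊥ (i + 1) = rowVar q τ ⊥ i := fun i => by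
    rw [hbot, hbot, ← zpow_natCast τ 2, ← zpow_add₀ hτ]
    push_cast
    ring_nf
  have hzero : τ ^ 2 * rowVar q τ ⊥ 0 = τ := by
    rw [hbot]
    field_simp
    simp [hτ]
  have hgeom : ∀ M, (τ ^ 2) ^ (n + 1) * ∑ i ∈ Finset.range M, rowVar q τ ⊥ i ^ (n + 1)
      = ∑ i ∈ Finset.range M, rowVar q τ ⊥ i ^ (n + 1) + τ ^ (n + 1)
        - (τ ^ 2 * rowVar q τ ⊥ M) ^ (n + 1) := by
    intro M
    induction M with
    | zero => simp [hzero]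
    | succ M ih =>
      rw [Finset.sum_range_succ, mul_add, ih, hstep, ← mul_pow]
      ring
  have hNN : rowVar q τ eta N = rowVar q τ ⊥ N := by
    rw [rowVar_of_colLen_le hN, hbot]
  rw [powerSumSpec_eq hN, Finset.sum_range_succ, hNN, mul_add, mul_sub, hgeom, sq_pow_mul_const hτ hgen]
  simp only [mul_pow, ← Finset.mul_sum]
  ring

theorem inv_sq_pow_mul_powerSumSpec (hτ : τ ≠ 0) (hgen : Generic q τ) (hN : eta.colLen 0 ≤ N)
    (n : ℕ) :
    ((τ ^ 2)⁻¹) ^ (n + 1) * powerSumSpec q τ eta (n + 1)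
      = powerSumSpec q τ eta (n + 1) - ∑ i ∈ Finset.range (N + 1), rowVar q τ eta i ^ (n + 1)
        + ∑ i ∈ Finset.range N, ((τ ^ 2)⁻¹ * rowVar q τ eta i) ^ (n + 1) := by
  have h := sq_pow_mul_powerSumSpec hτ hgen hN n
  simp only [mul_pow, ← Finset.mul_sum] at h ⊢
  have hT : (τ ^ 2) ^ (n + 1) ≠ 0 := pow_ne_zero _ (pow_ne_zero _ hτ)
  rw [inv_pow]
  field_simp
  linear_combination -h

theorem coe_prod_one_sub {ι : Type*} (s : Finset ι) (x : ι → K) :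
    ((∏ j ∈ s, (1 - Polynomial.C (x j) * Polynomial.X) : K[X]) : PowerSeries K)
      = ∏ j ∈ s, (1 - PowerSeries.C (x j) * PowerSeries.X) := by
  rw [← Polynomial.coeToPowerSeries.ringHom_apply, map_prod]
  simp

variable [CharZero K]

/-- The series of signed elementary symmetric functions of `q^η t^ρ`. -/
def rowSeries (q τ : K) (eta : YoungDiagram) : PowerSeries K := genSeries (powerSumSpec q τ eta)

/-- The same series with the variable of row `i` removed. -/
def rowSeriesErase (q τ : K) (eta : YoungDiagram) (i : ℕ) : PowerSeries K :=
  genSeries fun n => powerSumSpec q τ eta n - rowVar q τ eta i ^ n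

theorem rowSeries_eq_mul_erase (q τ : K) (eta : YoungDiagram) (i : ℕ) :
    rowSeries q τ eta
      = (1 - PowerSeries.C (rowVar q τ eta i) * PowerSeries.X) * rowSeriesErase q τ eta i := by
  rw [rowSeriesErase, ← genSeries_add_pow, rowSeries]
  simp

theorem rowSeriesErase_eq (s : Finset ℕ) {i : ℕ} (hi : i ∈ s) :
    rowSeriesErase q τ eta i
      = (∏ j ∈ s.erase i, (1 - PowerSeries.C (rowVar q τ eta j) * PowerSeries.X)) *
        genSeries fun n => powerSumSpec q τ eta n - ∑ j ∈ s, rowVar q τ eta j ^ n := by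
  rw [← genSeries_add_sum_pow, rowSeriesErase]
  congr 1
  ext n
  rw [← Finset.add_sum_erase _ _ hi]
  ring

theorem rowSeries_eq (s : Finset ℕ) :
    rowSeries q τ eta
      = (∏ j ∈ s, (1 - PowerSeries.C (rowVar q τ eta j) * PowerSeries.X)) *
        genSeries fun n => powerSumSpec q τ eta n - ∑ j ∈ s, rowVar q τ eta j ^ n := by
  rw [← genSeries_add_sum_pow, rowSeries]
  simp

/-- Interpolate ∏_{j<N} (1 - t⁻¹ x_j w), of degree at most N, at the N + 1 points 1/x_i, and
multiply by the common tail. -/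
theorem sum_upCoeff_mul (hq : q ≠ 0) (hτ : τ ≠ 0) (hgen : Generic q τ) (hN : eta.colLen 0 ≤ N) :
    ∑ i ∈ Finset.range (N + 1),
        PowerSeries.C (upCoeff q τ eta N i) * rowSeriesErase q τ eta i
      = PowerSeries.rescale (τ ^ 2)⁻¹ (rowSeries q τ eta) := by
  set x := rowVar q τ eta with hx
  have hpoly := eq_sum_prod_one_sub (s := Finset.range (N + 1)) (x := x)
    (P := ∏ j ∈ Finset.range N, (1 - Polynomial.C ((τ ^ 2)⁻¹ * x j) * Polynomial.X))
    (fun i _ => rowVar_ne_zero hq hτ eta i)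
    (fun i _ j _ hij => hgen.one_sub_rowVar_div_ne hq hτ eta hij) (by
      refine Polynomial.degree_le_natDegree.trans_lt ?_
      have h1 := natDegree_prod_one_sub_le (Finset.range N) fun j => (τ ^ 2)⁻¹ * x j
      rw [Finset.card_range] at h1 ⊢
      exact_mod_cast Nat.lt_succ_of_le h1)
  have hup : ∀ i, (∏ j ∈ Finset.range N,
      (1 - Polynomial.C ((τ ^ 2)⁻¹ * x j) * Polynomial.X)).eval (x i)⁻¹ /
        ∏ j ∈ (Finset.range (N + 1)).erase i, (1 - x j / x i) = upCoeff q τ eta N i := by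
    intro i
    rw [Polynomial.eval_prod, upCoeff]
    congr 1
    refine Finset.prod_congr rfl fun j _ => ?_
    simp [div_eq_mul_inv]
    ring
  simp only [hup] at hpoly
  have hser := congrArg (fun P : K[X] => (P : PowerSeries K)) hpoly
  simp only [coe_prod_one_sub] at hser
  rw [← Polynomial.coeToPowerSeries.ringHom_apply, map_sum] at hser
  simp only [Polynomial.coeToPowerSeries.ringHom_apply, Polynomial.coe_mul, coe_prod_one_sub,
    Polynomial.coe_C] at hser
  have hscale : PowerSeries.rescale (τ ^ 2)⁻¹ (rowSeries q τ eta)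
      = (∏ j ∈ Finset.range N, (1 - PowerSeries.C ((τ ^ 2)⁻¹ * x j) * PowerSeries.X)) *
        genSeries fun n => powerSumSpec q τ eta n - ∑ j ∈ Finset.range (N + 1), x j ^ n := by
    rw [rowSeries, ← genSeries_scale, ← genSeries_add_sum_pow]
    exact genSeries_congr fun n => inv_sq_pow_mul_powerSumSpec hτ hgen hN n
  rw [hscale, hser, Finset.sum_mul]
  refine Finset.sum_congr rfl fun i hi => ?_
  rw [rowSeriesErase_eq _ hi, mul_assoc]

/-- With A = ∏_{j<N} (1 - x_j w) and B = ∏_{j≤N} (1 - t x_j w), interpolate A + τ⁻¹(B - A)/w at the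
N points 1/x_i. There A vanishes, so the values come from B alone. -/
theorem X_mul_sum_downCoeff_mul (hq : q ≠ 0) (hτ : τ ≠ 0) (hgen : Generic q τ)
    (hN : eta.colLen 0 ≤ N) :
    PowerSeries.X * ∑ i ∈ Finset.range N,
        PowerSeries.C (downCoeff q τ eta N i) * rowSeriesErase q τ eta i
      = PowerSeries.X * rowSeries q τ eta + PowerSeries.C τ⁻¹ *
        (PowerSeries.rescale (τ ^ 2) (rowSeries q τ eta) - rowSeries q τ eta) := by
  set x := rowVar q τ eta with hx
  have hx0 : ∀ i, x i ≠ 0 := rowVar_ne_zero hq hτ eta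
  set A : K[X] := ∏ j ∈ Finset.range N, (1 - Polynomial.C (x j) * Polynomial.X) with hA
  set B : K[X] := ∏ j ∈ Finset.range (N + 1), (1 - Polynomial.C (τ ^ 2 * x j) * Polynomial.X)
    with hB
  have hA0 : ∀ i ∈ Finset.range N, A.eval (x i)⁻¹ = 0 := fun i hi => by
    rw [hA, Polynomial.eval_prod, Finset.prod_eq_zero hi]
    simp [hx0 i]
  have hAdeg : A.natDegree ≤ N := by
    simpa using natDegree_prod_one_sub_le (Finset.range N) x
  have hBdeg : B.natDegree ≤ N + 1 := by
    simpa using natDegree_prod_one_sub_le (Finset.range (N + 1)) fun j => τ ^ 2 * x j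
  have hAc : A.coeff N = ∏ j ∈ Finset.range N, -x j := by
    simpa using coeff_card_prod_one_sub (Finset.range N) x
  have hBc : B.coeff (N + 1) = ∏ j ∈ Finset.range (N + 1), -(τ ^ 2 * x j) := by
    simpa using coeff_card_prod_one_sub (Finset.range (N + 1)) fun j => τ ^ 2 * x j
  have hAB : Polynomial.X ∣ B - A := by
    rw [Polynomial.X_dvd_iff, Polynomial.coeff_zero_eq_eval_zero]
    simp [hA, hB, Polynomial.eval_prod]
  obtain ⟨E, hE⟩ := hAB
  set P : K[X] := A + Polynomial.C τ⁻¹ * E with hP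
  have hXP : Polynomial.X * P = Polynomial.X * A + Polynomial.C τ⁻¹ * (B - A) := by
    rw [hE, hP]; ring
  have hXPdeg : (Polynomial.X * P).natDegree ≤ N + 1 := by
    rw [hXP]
    refine Polynomial.natDegree_add_le_of_degree_le ?_ ?_
    · refine Polynomial.natDegree_mul_le.trans ?_
      rw [Polynomial.natDegree_X]; omega
    · refine (Polynomial.natDegree_C_mul_le _ _).trans ?_
      exact (Polynomial.natDegree_sub_le _ _).trans (max_le hBdeg (by omega))
  -- N nodes only suffice because the terms of degree N cancel: τ⁻¹ t^{N+1} x_N = 1. This is why A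
  -- is added to τ⁻¹(B - A)/w.
  have hlead : P.coeff N = 0 := by
    have h1 : (Polynomial.X * P).coeff (N + 1) = P.coeff N := Polynomial.coeff_X_mul _ _
    rw [← h1, hXP, Polynomial.coeff_add, Polynomial.coeff_X_mul, Polynomial.coeff_C_mul,
      Polynomial.coeff_sub, hBc, hAc, Polynomial.coeff_eq_zero_of_natDegree_lt (p := A) (by omega),
      Finset.prod_range_succ]
    simp only [← mul_neg, Finset.prod_mul_distrib, Finset.prod_const, Finset.card_range]
    rw [hx, rowVar_of_colLen_le hN]
    have h2 : (τ ^ 2) ^ N * (τ ^ 2 * τ ^ (-(2 * (N : ℤ) + 1))) = τ := by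
      rw [← zpow_natCast (τ ^ 2), ← zpow_natCast τ 2, ← zpow_mul, ← zpow_add₀ hτ, ← zpow_add₀ hτ]
      conv_rhs => rw [← zpow_one τ]
      congr 1
      push_cast
      ring
    have h3 : τ⁻¹ * τ = 1 := inv_mul_cancel₀ hτ
    linear_combination (-(∏ j ∈ Finset.range N, -rowVar q τ eta j) * τ⁻¹) * h2
      - (∏ j ∈ Finset.range N, -rowVar q τ eta j) * h3
  have hPdeg : P.degree < (Finset.range N).card := by
    rw [Finset.card_range, Polynomial.degree_lt_iff_coeff_zero]
    intro m hm
    rcases hm.lt_or_eq with h | rfl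
    · rw [← Polynomial.coeff_X_mul]
      exact Polynomial.coeff_eq_zero_of_natDegree_lt (by omega)
    · exact hlead
  have hpoly := eq_sum_prod_one_sub (s := Finset.range N) (x := x) (fun i _ => hx0 i)
    (fun i _ j _ hij => hgen.one_sub_rowVar_div_ne hq hτ eta hij) hPdeg
  have hdown : ∀ i ∈ Finset.range N,
      P.eval (x i)⁻¹ / ∏ j ∈ (Finset.range N).erase i, (1 - x j / x i)
        = downCoeff q τ eta N i := by
    intro i hi
    rw [downCoeff]
    congr 1
    have h1 := congrArg (Polynomial.eval (x i)⁻¹) hXP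
    simp only [Polynomial.eval_add, Polynomial.eval_mul, Polynomial.eval_sub, Polynomial.eval_X,
      Polynomial.eval_C, hA0 i hi] at h1
    have h2 : B.eval (x i)⁻¹ = ∏ j ∈ Finset.range (N + 1), (1 - τ ^ 2 * x j / x i) := by
      rw [hB, Polynomial.eval_prod]
      exact Finset.prod_congr rfl fun j _ => by simp [div_eq_mul_inv]
    rw [h2, inv_mul_eq_iff_eq_mul₀ (hx0 i)] at h1
    rw [h1]
    ring
  rw [Finset.sum_congr rfl fun i hi => by rw [hdown i hi]] at hpoly
  have hser := congrArg (fun Q : K[X] => ((Polynomial.X * Q : K[X]) : PowerSeries K)) hpoly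
  simp only [hXP] at hser
  simp only [← Polynomial.coeToPowerSeries.ringHom_apply, map_sum, map_mul, map_add, map_sub]
    at hser
  simp only [Polynomial.coeToPowerSeries.ringHom_apply, coe_prod_one_sub, hA, hB,
    Polynomial.coe_C, Polynomial.coe_X] at hser
  have hscale : PowerSeries.rescale (τ ^ 2) (rowSeries q τ eta)
      = (∏ j ∈ Finset.range (N + 1), (1 - PowerSeries.C (τ ^ 2 * x j) * PowerSeries.X)) *
        genSeries fun n => powerSumSpec q τ eta n - ∑ j ∈ Finset.range N, x j ^ n := by
    rw [rowSeries, ← genSeries_scale, ← genSeries_add_sum_pow]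
    exact genSeries_congr fun n => sq_pow_mul_powerSumSpec hτ hgen hN n
  rw [hscale, rowSeries_eq (Finset.range N), ← sub_mul, ← mul_assoc, ← mul_assoc, ← add_mul, hser,
    mul_assoc, Finset.sum_mul]
  congr 1
  refine Finset.sum_congr rfl fun i hi => ?_
  rw [rowSeriesErase_eq _ hi, mul_assoc]

end PartialFractions

/-! ### The recursion and its uniqueness -/

section Recursion

/-- The recursion that determines the correlators of the Hopf link from `a 0 0`. -/
structure HopfRecursion {R : Type*} [CommRing R] (x q t ti : R) (a : ℕ → ℕ → R) : Prop where
  zero_right : ∀ r, a r 0 + ti * (t ^ (2 * (r + 1)) - 1) * a (r + 1) 0 = x * ti ^ (2 * r) * a r 0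
  step : ∀ r s, a r (s + 1) + ti * (t ^ (2 * (r + 1)) - 1) * a (r + 1) (s + 1)
      - (a (r + 1) s + ti * (t ^ (2 * (r + 2)) - 1) * a (r + 2) s)
    = x * ti ^ (2 * r) * a r (s + 1)
      - x * (q * ti ^ (2 * (r + 1)) + (1 - q) * ti ^ (2 * s)) * a (r + 1) s
  symm : ∀ s, a 0 s = a s 0

theorem HopfRecursion.map {R S : Type*} [CommRing R] [CommRing S] {x q t ti : R} {a : ℕ → ℕ → R}
    (h : HopfRecursion x q t ti a) (φ : R →+* S) :
    HopfRecursion (φ x) (φ q) (φ t) (φ ti) fun r s => φ (a r s) where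
  zero_right r := by simpa using congrArg φ (h.zero_right r)
  step r s := by simpa using congrArg φ (h.step r s)
  symm s := congrArg φ (h.symm s)

theorem HopfRecursion.const_mul {R : Type*} [CommRing R] {x q t ti : R} {a : ℕ → ℕ → R}
    (h : HopfRecursion x q t ti a) (c : R) :
    HopfRecursion x q t ti fun r s => c * a r s where
  zero_right r := by linear_combination c * h.zero_right r
  step r s := by linear_combination c * h.step r s
  symm s := by rw [h.symm s]

/-- `zero_right` yields the values at (r, 0) and `symm` those at (0, s). Then `step` gives (r + 1, s
+ 1) from (r, s + 1) and from two entries with second index s, because the coefficient of that entry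
is nonzero. -/
theorem HopfRecursion.unique {R : Type*} [CommRing R] [IsDomain R] {x q t ti : R}
    {a b : ℕ → ℕ → R} (ha : HopfRecursion x q t ti a) (hb : HopfRecursion x q t ti b)
    (hti : ti ≠ 0) (ht : ∀ r, t ^ (2 * (r + 1)) - 1 ≠ 0) (h0 : a 0 0 = b 0 0) (r s : ℕ) :
    a r s = b r s := by
  have hγ : ∀ r, ti * (t ^ (2 * (r + 1)) - 1) ≠ 0 := fun r => mul_ne_zero hti (ht r)
  have hz : ∀ r, a r 0 = b r 0 := by
    intro r
    induction r with
    | zero => exact h0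
    | succ r ih =>
      refine mul_left_cancel₀ (hγ r) ?_
      linear_combination ha.zero_right r - hb.zero_right r + (x * ti ^ (2 * r) - 1) * ih
  induction s generalizing r with
  | zero => exact hz r
  | succ s ihs =>
    induction r with
    | zero => rw [ha.symm, hb.symm, hz]
    | succ r ihr =>
      refine mul_left_cancel₀ (hγ r) ?_
      linear_combination ha.step r s - hb.step r s + (x * ti ^ (2 * r) - 1) * ihr
        + (1 - x * (q * ti ^ (2 * (r + 1)) + (1 - q) * ti ^ (2 * s))) * ihs (r + 1)
        + ti * (t ^ (2 * (r + 2)) - 1) * ihs (r + 2)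

end Recursion

/-! ### The correlators satisfy the recursion -/

section Correlators

variable {K : Type*} [Field K] [CharZero K] {q τ : K} {eta : YoungDiagram} {i N : ℕ}

/-- `(-1) ^ r e_r(q^η t^ρ)`. -/
def rowCoeff (q τ : K) (eta : YoungDiagram) (r : ℕ) : K :=
  PowerSeries.coeff r (rowSeries q τ eta)

/-- The analogue of `rowCoeff` with the variable of row `i` removed. -/
def eraseCoeff (q τ : K) (eta : YoungDiagram) (i r : ℕ) : K :=
  PowerSeries.coeff r (rowSeriesErase q τ eta i)

theorem rowCoeff_zero (q τ : K) (eta : YoungDiagram) : rowCoeff q τ eta 0 = 1 :=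
  coeff_zero_genSeries _

theorem eraseCoeff_zero (q τ : K) (eta : YoungDiagram) (i : ℕ) : eraseCoeff q τ eta i 0 = 1 :=
  coeff_zero_genSeries _

theorem rowCoeff_succ (q τ : K) (eta : YoungDiagram) (i r : ℕ) :
    rowCoeff q τ eta (r + 1)
      = eraseCoeff q τ eta i (r + 1) - rowVar q τ eta i * eraseCoeff q τ eta i r := by
  rw [rowCoeff, rowSeries_eq_mul_erase q τ eta i, sub_mul, one_mul, map_sub, mul_assoc,
    PowerSeries.coeff_C_mul, PowerSeries.coeff_succ_X_mul]
  rfl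

theorem rowSeriesErase_addBox (h : Addable eta i) :
    rowSeriesErase q τ (addBox eta i h) i = rowSeriesErase q τ eta i := by
  refine genSeries_congr fun n => ?_
  set N := (addBox eta i h).colLen 0 + i + 1 with hN
  have h1 : eta.colLen 0 ≤ N := by
    have := colLen_addBox h 0
    omega
  have hi : i ∈ Finset.range N := Finset.mem_range.2 (by omega)
  rw [powerSumSpec_eq (show (addBox eta i h).colLen 0 ≤ N by omega), powerSumSpec_eq h1,
    ← Finset.add_sum_erase _ _ hi, ← Finset.add_sum_erase (Finset.range N)
      (fun j => rowVar q τ eta j ^ (n + 1)) hi,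
    Finset.sum_congr rfl fun j hj => by rw [rowVar_addBox_of_ne h (Finset.ne_of_mem_erase hj)]]
  ring

/-- Only the factor of row `i` changes, and 1 - q x w = q(1 - x w) + (1 - q). -/
theorem rowCoeff_addBox (h : Addable eta i) (r : ℕ) :
    rowCoeff q τ (addBox eta i h) r
      = q * rowCoeff q τ eta r + (1 - q) * eraseCoeff q τ eta i r := by
  have key : rowSeries q τ (addBox eta i h) = PowerSeries.C q * rowSeries q τ eta
      + PowerSeries.C (1 - q) * rowSeriesErase q τ eta i := by
    rw [rowSeries_eq_mul_erase q τ _ i, rowSeries_eq_mul_erase q τ eta i, rowSeriesErase_addBox,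
      rowVar_addBox_self, map_mul, map_sub, map_one]
    ring
  rw [rowCoeff, key, map_add, PowerSeries.coeff_C_mul, PowerSeries.coeff_C_mul]
  rfl

theorem eraseCoeff_addBox (h : Addable eta i) (r : ℕ) :
    eraseCoeff q τ (addBox eta i h) i r = eraseCoeff q τ eta i r := by
  rw [eraseCoeff, rowSeriesErase_addBox, eraseCoeff]

/-- The x_i-terms cancel in the antisymmetric combination. The right side is linear in erased
coefficients, so it can be summed against `upCoeff`. -/
theorem eraseCoeff_cross (q τ : K) (eta : YoungDiagram) (i r s : ℕ) :
    eraseCoeff q τ eta i r * eraseCoeff q τ eta i (s + 1)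
        - eraseCoeff q τ eta i (r + 1) * eraseCoeff q τ eta i s
      = eraseCoeff q τ eta i r * rowCoeff q τ eta (s + 1)
        - rowCoeff q τ eta (r + 1) * eraseCoeff q τ eta i s := by
  rw [rowCoeff_succ q τ eta i, rowCoeff_succ q τ eta i]
  ring

theorem sum_upCoeff_mul_eraseCoeff (hq : q ≠ 0) (hτ : τ ≠ 0) (hgen : Generic q τ)
    (hN : eta.colLen 0 ≤ N) (r : ℕ) :
    ∑ i ∈ Finset.range (N + 1), upCoeff q τ eta N i * eraseCoeff q τ eta i r
      = τ⁻¹ ^ (2 * r) * rowCoeff q τ eta r := by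
  have h := congrArg (PowerSeries.coeff r) (sum_upCoeff_mul hq hτ hgen hN)
  simp only [map_sum, PowerSeries.coeff_C_mul, PowerSeries.coeff_rescale] at h
  rw [pow_mul, inv_pow]
  exact h

theorem sum_downCoeff_mul_eraseCoeff (hq : q ≠ 0) (hτ : τ ≠ 0) (hgen : Generic q τ)
    (hN : eta.colLen 0 ≤ N) (r : ℕ) :
    ∑ i ∈ Finset.range N, downCoeff q τ eta N i * eraseCoeff q τ eta i r
      = rowCoeff q τ eta r
        + τ⁻¹ * (τ ^ (2 * (r + 1)) - 1) * rowCoeff q τ eta (r + 1) := by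
  have h := congrArg (PowerSeries.coeff (r + 1)) (X_mul_sum_downCoeff_mul hq hτ hgen hN)
  simp only [map_add, map_sub, map_sum, PowerSeries.coeff_C_mul, PowerSeries.coeff_rescale,
    PowerSeries.coeff_succ_X_mul] at h
  change ∑ i ∈ Finset.range N, downCoeff q τ eta N i * eraseCoeff q τ eta i r
    = rowCoeff q τ eta r
      + τ⁻¹ * ((τ ^ 2) ^ (r + 1) * rowCoeff q τ eta (r + 1) - rowCoeff q τ eta (r + 1)) at h
  rw [h, pow_mul]
  ring

/-- The unnormalized correlator `∑_η (-1) ^ (r + s) e_r e_s ∏ Q / (⋯)`. -/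
def correlator (q τ : K) (r s : ℕ) : PowerSeries K :=
  PowerSeries.mk fun n => ∑ eta ∈ diagramsOfSize n,
    boxWeight q τ eta * (rowCoeff q τ eta r * rowCoeff q τ eta s)

theorem correlator_comm (q τ : K) (r s : ℕ) : correlator q τ r s = correlator q τ s r := by
  simp only [correlator, mul_comm (rowCoeff q τ _ r)]

theorem Z_column_column (q τ : K) (r s : ℕ) :
    Z q τ (column r) (column s) = (-1) ^ (r + s) * correlator q τ r s := by
  ext n
  have h1 : ((-1) ^ (r + s) : PowerSeries K) = PowerSeries.C ((-1) ^ (r + s)) := by simp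
  rw [h1, PowerSeries.coeff_C_mul, Z, correlator, PowerSeries.coeff_mk, PowerSeries.coeff_mk,
    Finset.mul_sum]
  refine Finset.sum_congr rfl fun eta _ => ?_
  rw [schur_column, schur_column, elemSymm_eq, elemSymm_eq, pow_add]
  change (-1) ^ r * rowCoeff q τ eta r * ((-1) ^ s * rowCoeff q τ eta s) * boxWeight q τ eta = _
  ring

theorem Z_bot_bot (q τ : K) : Z q τ ⊥ ⊥ = correlator q τ 0 0 := by
  ext n
  simp [Z, correlator, schur_bot, rowCoeff_zero]

theorem diagramsOfSize_zero : diagramsOfSize 0 = {⊥} := by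
  ext eta
  rw [mem_diagramsOfSize, Finset.mem_singleton]
  constructor
  · intro h
    exact YoungDiagram.ext (Finset.card_eq_zero.1 h)
  · rintro rfl
    rfl

theorem constantCoeff_Z_bot_bot (q τ : K) : PowerSeries.constantCoeff (Z q τ ⊥ ⊥) = 1 := by
  rw [← PowerSeries.coeff_zero_eq_constantCoeff_apply]
  simp [Z, diagramsOfSize_zero, schur_bot, boxWeight]

/-- Expand over the rows by `downCoeff`, move the box across by detailed balance, and resum the
linear part by `upCoeff`. The quadratic part is left as it is. -/
theorem sum_boxWeight_mul_downCoeff (hq : q ≠ 0) (hτ : τ ≠ 0) (hgen : Generic q τ) (n r s : ℕ) :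
    ∑ theta ∈ diagramsOfSize (n + 1), boxWeight q τ theta *
        ((rowCoeff q τ theta r
          + τ⁻¹ * (τ ^ (2 * (r + 1)) - 1) * rowCoeff q τ theta (r + 1)) * rowCoeff q τ theta s)
      = ∑ eta ∈ diagramsOfSize n, boxWeight q τ eta *
        (q * (τ⁻¹ ^ (2 * r) * rowCoeff q τ eta r) * rowCoeff q τ eta s
          + (1 - q) * ∑ i ∈ Finset.range (n + 2), upCoeff q τ eta (n + 1) i *
            (eraseCoeff q τ eta i r * eraseCoeff q τ eta i s)) := by
  have hcol : ∀ {eta : YoungDiagram} {m : ℕ}, eta.card = m → eta.colLen 0 ≤ m :=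
    fun {eta} m h => h ▸ colLen_zero_le_card eta
  calc _ = ∑ theta ∈ diagramsOfSize (n + 1), ∑ i ∈ Finset.range (n + 1),
        boxWeight q τ theta * downCoeff q τ theta (n + 1) i *
          (eraseCoeff q τ theta i r * rowCoeff q τ theta s) := by
        refine Finset.sum_congr rfl fun theta ht => ?_
        rw [← sum_downCoeff_mul_eraseCoeff hq hτ hgen (hcol (mem_diagramsOfSize.1 ht)),
          Finset.sum_mul, Finset.mul_sum]
        exact Finset.sum_congr rfl fun i _ => by ring
    _ = ∑ eta ∈ diagramsOfSize n, ∑ i ∈ Finset.range (n + 1),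
        boxWeight q τ eta * upCoeff q τ eta (n + 1) i * (eraseCoeff q τ eta i r *
          (q * rowCoeff q τ eta s + (1 - q) * eraseCoeff q τ eta i s)) := by
        rw [Finset.sum_comm, Finset.sum_comm (s := diagramsOfSize n)]
        refine Finset.sum_congr rfl fun i hi => ?_
        have hi' := Finset.mem_range.1 hi
        refine (sum_addBox_eq_sum_removeBox n i _ _ ?_ ?_ ?_).symm
        · intro eta _ h
          rw [upCoeff_eq_zero hq hτ hi'.le h, mul_zero, zero_mul]
        · intro theta _ h
          rw [downCoeff_eq_zero hq hτ hi' h, mul_zero, zero_mul]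
        · intro eta he h
          rw [boxWeight_mul_upCoeff hgen hq hτ h (hcol (by rw [card_addBox, he])),
            rowCoeff_addBox, eraseCoeff_addBox]
    _ = _ := by
        refine Finset.sum_congr rfl fun eta he => ?_
        have hlen : eta.colLen 0 ≤ n := hcol (mem_diagramsOfSize.1 he)
        rw [← sum_upCoeff_mul_eraseCoeff hq hτ hgen (hlen.trans (Nat.le_succ n)), Finset.mul_sum,
          Finset.mul_sum, Finset.sum_mul, ← Finset.sum_add_distrib, Finset.mul_sum,
          Finset.sum_range_succ _ (n + 1)]
        -- The `upCoeff` sum has one row more than the `downCoeff` sum; with n boxes, row n is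
        -- already empty, so the extra term vanishes.
        have hnot : ¬ Addable eta (n + 1) := fun h => by
          have := h n (Nat.lt_succ_self n)
          rw [rowLen_eq_zero hlen] at this
          omega
        rw [upCoeff_eq_zero hq hτ le_rfl hnot]
        simp only [zero_mul, mul_zero, add_zero]
        exact Finset.sum_congr rfl fun i _ => by ring

/-- The empty diagram has no box to remove: with cutoff 0 the sum over rows is empty. -/
theorem rowCoeff_bot (hq : q ≠ 0) (hτ : τ ≠ 0) (hgen : Generic q τ) (r : ℕ) :
    rowCoeff q τ ⊥ r + τ⁻¹ * (τ ^ (2 * (r + 1)) - 1) * rowCoeff q τ ⊥ (r + 1) = 0 := by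
  rw [← sum_downCoeff_mul_eraseCoeff hq hτ hgen (N := 0) (colLen_zero_le_card ⊥)]
  simp

theorem coeff_zero_correlator_add (hq : q ≠ 0) (hτ : τ ≠ 0) (hgen : Generic q τ) (r s : ℕ) :
    PowerSeries.coeff 0 (correlator q τ r s)
      + τ⁻¹ * (τ ^ (2 * (r + 1)) - 1) * PowerSeries.coeff 0 (correlator q τ (r + 1) s) = 0 := by
  simp only [correlator, PowerSeries.coeff_mk, diagramsOfSize_zero, Finset.sum_singleton]
  linear_combination (boxWeight q τ ⊥ * rowCoeff q τ ⊥ s) * rowCoeff_bot hq hτ hgen r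

theorem coeff_succ_correlator_add (hq : q ≠ 0) (hτ : τ ≠ 0) (hgen : Generic q τ) (n r s : ℕ) :
    PowerSeries.coeff (n + 1) (correlator q τ r s)
      + τ⁻¹ * (τ ^ (2 * (r + 1)) - 1) * PowerSeries.coeff (n + 1) (correlator q τ (r + 1) s)
      = ∑ eta ∈ diagramsOfSize n, boxWeight q τ eta *
        (q * (τ⁻¹ ^ (2 * r) * rowCoeff q τ eta r) * rowCoeff q τ eta s
          + (1 - q) * ∑ i ∈ Finset.range (n + 2), upCoeff q τ eta (n + 1) i *
            (eraseCoeff q τ eta i r * eraseCoeff q τ eta i s)) := by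
  rw [← sum_boxWeight_mul_downCoeff hq hτ hgen]
  simp only [correlator, PowerSeries.coeff_mk]
  rw [Finset.mul_sum, ← Finset.sum_add_distrib]
  exact Finset.sum_congr rfl fun theta _ => by ring

/-- The slot `t` of `HopfRecursion` holds the square root τ. The factor X records the box lost in
passing from n + 1 to n; at Q⁰ both sides vanish by `rowCoeff_bot`. -/
theorem hopfRecursion_correlator (hq : q ≠ 0) (hτ : τ ≠ 0) (hgen : Generic q τ) :
    HopfRecursion PowerSeries.X (PowerSeries.C q) (PowerSeries.C τ) (PowerSeries.C τ⁻¹)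
      (correlator q τ) where
  symm s := correlator_comm q τ 0 s
  zero_right r := by
    have e1 : PowerSeries.C τ⁻¹ * (PowerSeries.C τ ^ (2 * (r + 1)) - 1)
        = PowerSeries.C (τ⁻¹ * (τ ^ (2 * (r + 1)) - 1)) := by simp
    have e2 : PowerSeries.X * PowerSeries.C τ⁻¹ ^ (2 * r) * correlator q τ r 0
        = PowerSeries.X * (PowerSeries.C (τ⁻¹ ^ (2 * r)) * correlator q τ r 0) := by
      rw [map_pow]; ring
    rw [e1, e2]
    ext n
    rcases n with _ | n
    · simpa using coeff_zero_correlator_add hq hτ hgen r 0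
    · rw [map_add, PowerSeries.coeff_C_mul, coeff_succ_correlator_add hq hτ hgen,
        PowerSeries.coeff_succ_X_mul, PowerSeries.coeff_C_mul, correlator, PowerSeries.coeff_mk,
        Finset.mul_sum]
      refine Finset.sum_congr rfl fun eta he => ?_
      have hlen : eta.colLen 0 ≤ n + 1 := by
        have h1 := colLen_zero_le_card eta
        rw [mem_diagramsOfSize.1 he] at h1
        omega
      simp only [eraseCoeff_zero, rowCoeff_zero, mul_one]
      rw [sum_upCoeff_mul_eraseCoeff hq hτ hgen hlen]
      ring
  step r s := by
    have e1 : ∀ r, PowerSeries.C τ⁻¹ * (PowerSeries.C τ ^ (2 * (r + 1)) - 1)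
        = PowerSeries.C (τ⁻¹ * (τ ^ (2 * (r + 1)) - 1)) := fun r => by simp
    have e2 : PowerSeries.X * PowerSeries.C τ⁻¹ ^ (2 * r) * correlator q τ r (s + 1)
          - PowerSeries.X * (PowerSeries.C q * PowerSeries.C τ⁻¹ ^ (2 * (r + 1))
            + (1 - PowerSeries.C q) * PowerSeries.C τ⁻¹ ^ (2 * s)) * correlator q τ (r + 1) s
        = PowerSeries.X * (PowerSeries.C (τ⁻¹ ^ (2 * r)) * correlator q τ r (s + 1)
          - PowerSeries.C (q * τ⁻¹ ^ (2 * (r + 1)) + (1 - q) * τ⁻¹ ^ (2 * s))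
            * correlator q τ (r + 1) s) := by
      simp only [map_pow, map_add, map_mul, map_sub, map_one]; ring
    rw [e1, e1 (r + 1), e2]
    ext n
    rcases n with _ | n
    · have h1 := coeff_zero_correlator_add hq hτ hgen r (s + 1)
      have h2 := coeff_zero_correlator_add hq hτ hgen (r + 1) s
      rw [map_sub, map_add, map_add, PowerSeries.coeff_C_mul, PowerSeries.coeff_C_mul, h1, h2,
        PowerSeries.coeff_zero_X_mul, sub_zero]
    · rw [map_sub, map_add, map_add, PowerSeries.coeff_C_mul, PowerSeries.coeff_C_mul,
        coeff_succ_correlator_add hq hτ hgen, coeff_succ_correlator_add hq hτ hgen,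
        PowerSeries.coeff_succ_X_mul, map_sub, PowerSeries.coeff_C_mul, PowerSeries.coeff_C_mul,
        correlator, correlator, PowerSeries.coeff_mk, PowerSeries.coeff_mk, Finset.mul_sum,
        Finset.mul_sum, ← Finset.sum_sub_distrib, ← Finset.sum_sub_distrib]
      refine Finset.sum_congr rfl fun eta he => ?_
      have hlen : eta.colLen 0 ≤ n + 1 := by
        have h1 := colLen_zero_le_card eta
        rw [mem_diagramsOfSize.1 he] at h1
        omega
      have hcross : ∑ i ∈ Finset.range (n + 2), upCoeff q τ eta (n + 1) i *
            (eraseCoeff q τ eta i r * eraseCoeff q τ eta i (s + 1))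
          - ∑ i ∈ Finset.range (n + 2), upCoeff q τ eta (n + 1) i *
            (eraseCoeff q τ eta i (r + 1) * eraseCoeff q τ eta i s)
          = τ⁻¹ ^ (2 * r) * rowCoeff q τ eta r * rowCoeff q τ eta (s + 1)
            - rowCoeff q τ eta (r + 1) * (τ⁻¹ ^ (2 * s) * rowCoeff q τ eta s) := by
        rw [← sum_upCoeff_mul_eraseCoeff hq hτ hgen hlen,
          ← sum_upCoeff_mul_eraseCoeff hq hτ hgen hlen, Finset.sum_mul, Finset.mul_sum,
          ← Finset.sum_sub_distrib, ← Finset.sum_sub_distrib]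
        refine Finset.sum_congr rfl fun i _ => ?_
        linear_combination upCoeff q τ eta (n + 1) i * eraseCoeff_cross q τ eta i r s
      linear_combination boxWeight q τ eta * (1 - q) * hcross

end Correlators

/-! ### The closed form satisfies the recursion -/

section ClosedForm

variable {K : Type*} [Field K] {q τ : K}

theorem powerSumSpecQ_column (q τ : K) (r n : ℕ) :
    powerSumSpecQ q τ (column r) n
      = Polynomial.C (q ^ n - 1) *
          ∑ i ∈ Finset.range r, (Polynomial.X * Polynomial.C τ⁻¹ ^ (2 * i + 1)) ^ n
        + (Polynomial.X ^ n - 1) * Polynomial.C (1 / (τ ^ n - (τ ^ n)⁻¹)) := by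
  rw [powerSumSpecQ, colLen_column_zero]
  congr 1
  rw [map_sum, Finset.mul_sum, Finset.mul_sum]
  refine Finset.sum_congr rfl fun i hi => ?_
  have h1 : τ ^ (-((n : ℤ) * (2 * (i : ℤ) + 1))) = (τ⁻¹ ^ (2 * i + 1)) ^ n := by
    rw [← pow_mul, inv_pow, zpow_neg, ← zpow_natCast]
    congr 2
    push_cast
    ring
  rw [rowLen_column, if_pos (Finset.mem_range.1 hi), mul_one, h1, map_mul, map_pow, map_pow, mul_pow]
  ring

variable [CharZero K]

/-- The series of signed elementary symmetric functions of `(Q q^{(1^r)} t^ρ, t^{-ρ})`. -/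
def columnSeries (q τ : K) (r : ℕ) : PowerSeries K[X] :=
  genSeries (powerSumSpecQ q τ (column r))

/-- The part of `columnSeries` that is common to the columns of lengths `r` and `r + 1`. -/
def columnSeriesErase (q τ : K) (r : ℕ) : PowerSeries K[X] :=
  genSeries fun n => powerSumSpecQ q τ (column r) n
    - (Polynomial.X * Polynomial.C τ⁻¹ ^ (2 * r + 1)) ^ n

theorem columnSeries_eq (q τ : K) (r : ℕ) :
    columnSeries q τ r
      = (1 - PowerSeries.C (Polynomial.X * Polynomial.C τ⁻¹ ^ (2 * r + 1)) * PowerSeries.X)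
        * columnSeriesErase q τ r := by
  rw [columnSeriesErase, ← genSeries_add_pow, columnSeries]
  simp

/-- Lengthening the column replaces the variable Qτ^{-(2r+1)} by q times itself; the rest of the
alphabet stays. -/
theorem columnSeries_succ_eq (q τ : K) (r : ℕ) :
    columnSeries q τ (r + 1)
      = (1 - PowerSeries.C (Polynomial.C q * (Polynomial.X * Polynomial.C τ⁻¹ ^ (2 * r + 1)))
          * PowerSeries.X) * columnSeriesErase q τ r := by
  rw [columnSeriesErase, ← genSeries_add_pow, columnSeries]
  congr 1
  ext1 n
  rw [powerSumSpecQ_column, powerSumSpecQ_column, Finset.sum_range_succ, mul_pow (Polynomial.C q)]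
  simp only [map_sub, map_pow, map_one]
  ring

/-- Scaling by t shifts the row variables up by one. The top one becomes qτQ, and the negative
alphabet of t^{-ρ} gains τ, hence the linear factors on the two sides. -/
theorem columnSeriesErase_scale (hτ : τ ≠ 0) (hgen : Generic q τ) (r : ℕ) :
    (1 - PowerSeries.C (Polynomial.C τ) * PowerSeries.X) *
        PowerSeries.rescale (Polynomial.C τ ^ 2) (columnSeriesErase q τ (r + 1))
      = (1 - PowerSeries.C (Polynomial.C q * (Polynomial.C τ * Polynomial.X)) * PowerSeries.X) *
        columnSeriesErase q τ r := by
  rw [columnSeriesErase, columnSeriesErase, ← genSeries_scale, ← genSeries_add_pow,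
    ← genSeries_add_pow]
  refine genSeries_congr fun n => ?_
  have hinv : Polynomial.C τ * Polynomial.C τ⁻¹ = 1 := by
    rw [← map_mul, mul_inv_cancel₀ hτ, map_one]
  have hc := congrArg Polynomial.C (sq_pow_mul_const hτ hgen n)
  simp only [map_add, map_mul, map_pow] at hc
  have hz : ∀ i : ℕ, (Polynomial.C τ ^ 2) * (Polynomial.X * Polynomial.C τ⁻¹ ^ (2 * (i + 1) + 1))
      = Polynomial.X * Polynomial.C τ⁻¹ ^ (2 * i + 1) := fun i => by
    rw [show 2 * (i + 1) + 1 = 2 * i + 1 + 2 by ring, pow_add]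
    linear_combination (Polynomial.X * Polynomial.C τ⁻¹ ^ (2 * i + 1)
      * (Polynomial.C τ * Polynomial.C τ⁻¹ + 1)) * hinv
  have hz0 : (Polynomial.C τ ^ 2) * (Polynomial.X * Polynomial.C τ⁻¹ ^ (2 * 0 + 1))
      = Polynomial.C τ * Polynomial.X := by
    linear_combination (Polynomial.C τ * Polynomial.X) * hinv
  have hsum : (Polynomial.C τ ^ 2) ^ (n + 1) * ∑ i ∈ Finset.range (r + 1),
        (Polynomial.X * Polynomial.C τ⁻¹ ^ (2 * i + 1)) ^ (n + 1)
      = ∑ i ∈ Finset.range r, (Polynomial.X * Polynomial.C τ⁻¹ ^ (2 * i + 1)) ^ (n + 1)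
        + (Polynomial.C τ * Polynomial.X) ^ (n + 1) := by
    rw [Finset.mul_sum, Finset.sum_range_succ', ← mul_pow, hz0]
    exact congrArg₂ (· + ·) (Finset.sum_congr rfl fun i _ => by rw [← mul_pow, hz]) rfl
  have hzr := congrArg (· ^ (n + 1)) (hz r)
  simp only [mul_pow (Polynomial.C τ ^ 2)] at hzr
  rw [powerSumSpecQ_column, powerSumSpecQ_column, mul_pow (Polynomial.C q),
    mul_pow (Polynomial.C τ) Polynomial.X]
  rw [mul_pow (Polynomial.C τ) Polynomial.X] at hsum
  rw [← map_pow Polynomial.C τ (n + 1), ← map_pow Polynomial.C q (n + 1), map_sub, map_one]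
  rw [← map_pow Polynomial.C τ (n + 1)] at hsum hc
  generalize (Polynomial.C τ ^ 2) ^ (n + 1) = T at *
  generalize ∑ i ∈ Finset.range (r + 1),
    (Polynomial.X * Polynomial.C τ⁻¹ ^ (2 * i + 1)) ^ (n + 1) = S1 at *
  generalize ∑ i ∈ Finset.range r,
    (Polynomial.X * Polynomial.C τ⁻¹ ^ (2 * i + 1)) ^ (n + 1) = S0 at *
  generalize (Polynomial.X * Polynomial.C τ⁻¹ ^ (2 * r + 1)) ^ (n + 1) = z0 at *
  generalize (Polynomial.X * Polynomial.C τ⁻¹ ^ (2 * (r + 1) + 1)) ^ (n + 1) = z1 at *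
  linear_combination (Polynomial.C (q ^ (n + 1)) - 1) * hsum + (Polynomial.X ^ (n + 1) - 1) * hc
    - hzr

theorem columnSeries_zero_scale (hτ : τ ≠ 0) (hgen : Generic q τ) :
    (1 - PowerSeries.C (Polynomial.C τ) * PowerSeries.X) *
        PowerSeries.rescale (Polynomial.C τ ^ 2) (columnSeries q τ 0)
      = (1 - PowerSeries.C (Polynomial.C τ * Polynomial.X) * PowerSeries.X) *
        columnSeries q τ 0 := by
  rw [columnSeries, ← genSeries_scale, ← genSeries_add_pow, ← genSeries_add_pow]
  refine genSeries_congr fun n => ?_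
  have hc := congrArg Polynomial.C (sq_pow_mul_const hτ hgen n)
  simp only [map_add, map_mul, map_pow] at hc
  rw [powerSumSpecQ_column, Finset.sum_range_zero, mul_zero, zero_add, mul_left_comm, hc, mul_pow]
  ring

theorem coeff_succ_one_sub_mul {R : Type*} [CommRing R] (c : R) (f : PowerSeries R) (n : ℕ) :
    PowerSeries.coeff (n + 1) ((1 - PowerSeries.C c * PowerSeries.X) * f)
      = PowerSeries.coeff (n + 1) f - c * PowerSeries.coeff n f := by
  rw [sub_mul, one_mul, map_sub, mul_assoc, PowerSeries.coeff_C_mul, PowerSeries.coeff_succ_X_mul]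

/-- `(-1) ^ s e_s(Q q^{(1^r)} t^ρ, t^{-ρ})`. -/
def columnCoeff (q τ : K) (r s : ℕ) : K[X] := PowerSeries.coeff s (columnSeries q τ r)

theorem columnCoeff_zero_right (q τ : K) (r : ℕ) : columnCoeff q τ r 0 = 1 :=
  coeff_zero_genSeries _

/-- The q-binomial type two-term relation for an alphabet that scaling by t changes in one positive
and one negative variable. -/
theorem columnCoeff_zero_succ (hτ : τ ≠ 0) (hgen : Generic q τ) (s : ℕ) :
    (Polynomial.C τ ^ (2 * (s + 1)) - 1) * columnCoeff q τ 0 (s + 1)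
      = Polynomial.C τ * (Polynomial.C τ ^ (2 * s) - Polynomial.X) * columnCoeff q τ 0 s := by
  have h := congrArg (PowerSeries.coeff (s + 1)) (columnSeries_zero_scale hτ hgen)
  rw [coeff_succ_one_sub_mul, coeff_succ_one_sub_mul, PowerSeries.coeff_rescale,
    PowerSeries.coeff_rescale, ← pow_mul, ← pow_mul] at h
  simp only [columnCoeff]
  linear_combination h

/-- The columns r, r + 1, r + 2 are all expressed through the erased series at r and r + 1. These
are tied together by the two expressions for column r + 1 and by the scaling relation. -/
theorem columnCoeff_three_term (hτ : τ ≠ 0) (hgen : Generic q τ) (r s : ℕ) :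
    Polynomial.C τ⁻¹ ^ (2 * s) * (Polynomial.C τ⁻¹ * (Polynomial.C τ ^ (2 * (r + 1)) - 1)) *
        (columnCoeff q τ r (s + 1) - columnCoeff q τ (r + 1) (s + 1))
      = columnCoeff q τ (r + 1) s * (1 - Polynomial.X *
          (Polynomial.C q * Polynomial.C τ⁻¹ ^ (2 * (r + 1))
            + (1 - Polynomial.C q) * Polynomial.C τ⁻¹ ^ (2 * s)))
        + (Polynomial.X * Polynomial.C τ⁻¹ ^ (2 * (r + 1)) - 1) * columnCoeff q τ (r + 2) s := by
  have hinv : Polynomial.C τ * Polynomial.C τ⁻¹ = 1 := by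
    rw [← map_mul, mul_inv_cancel₀ hτ, map_one]
  have hinvr : Polynomial.C τ ^ (2 * (r + 1)) * Polynomial.C τ⁻¹ ^ (2 * (r + 1)) = 1 := by
    rw [← mul_pow, hinv, one_pow]
  have h1 : ∀ n, columnCoeff q τ r (n + 1)
      = PowerSeries.coeff (n + 1) (columnSeriesErase q τ r)
        - Polynomial.X * Polynomial.C τ⁻¹ ^ (2 * r + 1)
          * PowerSeries.coeff n (columnSeriesErase q τ r) := fun n => by
    rw [columnCoeff, columnSeries_eq, coeff_succ_one_sub_mul]
  have h2 : ∀ n, columnCoeff q τ (r + 1) (n + 1)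
      = PowerSeries.coeff (n + 1) (columnSeriesErase q τ r)
        - Polynomial.C q * (Polynomial.X * Polynomial.C τ⁻¹ ^ (2 * r + 1))
          * PowerSeries.coeff n (columnSeriesErase q τ r) := fun n => by
    rw [columnCoeff, columnSeries_succ_eq, coeff_succ_one_sub_mul]
  have h3 : ∀ n, columnCoeff q τ (r + 1) (n + 1)
      = PowerSeries.coeff (n + 1) (columnSeriesErase q τ (r + 1))
        - Polynomial.X * Polynomial.C τ⁻¹ ^ (2 * (r + 1) + 1)
          * PowerSeries.coeff n (columnSeriesErase q τ (r + 1)) := fun n => by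
    rw [columnCoeff, columnSeries_eq, coeff_succ_one_sub_mul]
  have h4 : ∀ n, columnCoeff q τ (r + 2) (n + 1)
      = PowerSeries.coeff (n + 1) (columnSeriesErase q τ (r + 1))
        - Polynomial.C q * (Polynomial.X * Polynomial.C τ⁻¹ ^ (2 * (r + 1) + 1))
          * PowerSeries.coeff n (columnSeriesErase q τ (r + 1)) := fun n => by
    rw [columnCoeff, columnSeries_succ_eq, coeff_succ_one_sub_mul]
  have h5 : ∀ n, Polynomial.C τ ^ (2 * (n + 1))
        * PowerSeries.coeff (n + 1) (columnSeriesErase q τ (r + 1))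
        - Polynomial.C τ * (Polynomial.C τ ^ (2 * n)
          * PowerSeries.coeff n (columnSeriesErase q τ (r + 1)))
      = PowerSeries.coeff (n + 1) (columnSeriesErase q τ r)
        - Polynomial.C q * (Polynomial.C τ * Polynomial.X)
          * PowerSeries.coeff n (columnSeriesErase q τ r) := fun n => by
    have h := congrArg (PowerSeries.coeff (n + 1)) (columnSeriesErase_scale hτ hgen r)
    rwa [coeff_succ_one_sub_mul, coeff_succ_one_sub_mul, PowerSeries.coeff_rescale,
      PowerSeries.coeff_rescale, ← pow_mul, ← pow_mul] at h
  have hz : Polynomial.C τ⁻¹ ^ (2 * r + 1)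
      = Polynomial.C τ * Polynomial.C τ⁻¹ ^ (2 * (r + 1)) := by
    rw [show 2 * (r + 1) = 2 * r + 1 + 1 by ring, pow_succ _ (2 * r + 1)]
    linear_combination (-Polynomial.C τ⁻¹ ^ (2 * r + 1)) * hinv
  have hz' : Polynomial.C τ⁻¹ ^ (2 * (r + 1) + 1)
      = Polynomial.C τ⁻¹ * Polynomial.C τ⁻¹ ^ (2 * (r + 1)) := by
    rw [pow_succ]; ring
  rw [hz] at h1 h2
  rw [hz'] at h3 h4
  rw [h1, h2]
  generalize Polynomial.C τ⁻¹ ^ (2 * (r + 1)) = k at *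
  generalize Polynomial.C τ ^ (2 * (r + 1)) = k' at *
  have hk : Polynomial.C τ⁻¹ * (k' - 1) * (Polynomial.X * (Polynomial.C τ * k))
      = Polynomial.X * (1 - k) := by
    linear_combination Polynomial.X * (Polynomial.C τ⁻¹ * Polynomial.C τ) * hinvr
      + Polynomial.X * (1 - k) * hinv
  rcases s with _ | s
  · have hj : PowerSeries.coeff 0 (columnSeriesErase q τ r) = 1 := coeff_zero_genSeries _
    rw [columnCoeff_zero_right, columnCoeff_zero_right, hj]
    simp only [mul_zero, pow_zero]
    linear_combination (-(1 - Polynomial.C q)) * hk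
  · have hu : Polynomial.C τ ^ (2 * (s + 1)) * Polynomial.C τ⁻¹ ^ (2 * (s + 1)) = 1 := by
      rw [← mul_pow, hinv, one_pow]
    have hu' : Polynomial.C τ ^ (2 * s) * Polynomial.C τ⁻¹ ^ (2 * (s + 1))
        = Polynomial.C τ⁻¹ ^ 2 := by
      rw [mul_add, pow_add, ← mul_assoc, ← mul_pow, hinv, one_pow, one_mul, mul_one]
    have h23 := (h2 s).symm.trans (h3 s)
    have h5s := h5 s
    rw [h4, h3]
    generalize PowerSeries.coeff (s + 1) (columnSeriesErase q τ r) = j1 at *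
    generalize PowerSeries.coeff s (columnSeriesErase q τ r) = j0 at *
    generalize PowerSeries.coeff (s + 1) (columnSeriesErase q τ (r + 1)) = g1 at *
    generalize PowerSeries.coeff s (columnSeriesErase q τ (r + 1)) = g0 at *
    generalize Polynomial.C τ⁻¹ ^ (2 * (s + 1)) = u at *
    generalize Polynomial.C τ ^ (2 * (s + 1)) = u' at *
    generalize Polynomial.C τ ^ (2 * s) = v at *
    generalize Polynomial.C τ = t at *
    generalize Polynomial.C τ⁻¹ = ti at *
    generalize Polynomial.C q = Q at *
    generalize (Polynomial.X : K[X]) = x at *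
    -- The scaling relation divided by t^{s+1}.
    have hg : g1 - ti * g0 = u * (j1 - Q * (t * x) * j0) := by
      rw [← h5s]
      linear_combination (-g1) * hu + t * g0 * hu' + ti * g0 * hinv
    linear_combination (-(1 - Q) * u * j1) * hk - x * k * (1 - Q) * hg - x * (1 - Q) * u * h23

/-- With φ_r = f(1^r) c(0, r), where c is `columnCoeff`, one has γ_r φ_{r+1} = (Q t^{-r} - 1) φ_r.
This makes every term of `step` a multiple of φ_{r+1}, and the cofactor is the three-term relation.
-/
theorem hopfRecursion_columnCoeff (hτ : τ ≠ 0) (hgen : Generic q τ) :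
    HopfRecursion Polynomial.X (Polynomial.C q) (Polynomial.C τ) (Polynomial.C τ⁻¹)
      fun r s => Polynomial.C (framing (τ ^ 2) r * framing (τ ^ 2) s) * columnCoeff q τ 0 r
        * columnCoeff q τ r s := by
  have hinv : Polynomial.C τ * Polynomial.C τ⁻¹ = 1 := by
    rw [← map_mul, mul_inv_cancel₀ hτ, map_one]
  have hinvp : ∀ n, Polynomial.C τ ^ n * Polynomial.C τ⁻¹ ^ n = 1 := fun n => by
    rw [← mul_pow, hinv, one_pow]
  have hf : ∀ r, Polynomial.C (framing (τ ^ 2) (r + 1))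
      = -Polynomial.C τ⁻¹ ^ (2 * r) * Polynomial.C (framing (τ ^ 2) r) := fun r => by
    have h1 : (r + 1) * (r + 1 - 1) / 2 = r * (r - 1) / 2 + r := by
      rw [← Finset.sum_range_id_mul_two, ← Finset.sum_range_id_mul_two,
        Nat.mul_div_cancel _ two_pos, Nat.mul_div_cancel _ two_pos, Finset.sum_range_succ]
    rw [framing, framing, h1, ← map_pow, ← map_neg, ← map_mul, pow_add (τ ^ 2), mul_inv, inv_pow,
      pow_mul]
    congr 1
    ring
  have hφ : ∀ r, Polynomial.C τ⁻¹ * (Polynomial.C τ ^ (2 * (r + 1)) - 1) *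
        (Polynomial.C (framing (τ ^ 2) (r + 1)) * columnCoeff q τ 0 (r + 1))
      = (Polynomial.X * Polynomial.C τ⁻¹ ^ (2 * r) - 1) *
        (Polynomial.C (framing (τ ^ 2) r) * columnCoeff q τ 0 r) := fun r => by
    rw [hf]
    have h1 := columnCoeff_zero_succ hτ hgen r
    have h2 := hinvp (2 * r)
    generalize columnCoeff q τ 0 (r + 1) = c1 at *
    generalize columnCoeff q τ 0 r = c0 at *
    generalize Polynomial.C (framing (τ ^ 2) r) = f at *
    generalize Polynomial.C τ⁻¹ ^ (2 * r) = u at *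
    generalize Polynomial.C τ ^ (2 * r) = u' at *
    linear_combination (-Polynomial.C τ⁻¹ * u * f) * h1
      + (-u * f * (u' - Polynomial.X) * c0) * hinv - f * c0 * h2
  simp only [map_mul]
  refine ⟨fun r => ?_, fun r s => ?_, fun s => ?_⟩
  · rw [columnCoeff_zero_right, columnCoeff_zero_right]
    linear_combination Polynomial.C (framing (τ ^ 2) 0) * hφ r
  · have h1 := hφ r
    have h2 := hφ (r + 1)
    have h3 := columnCoeff_three_term hτ hgen r s
    rw [hf s]
    rw [show r + 1 + 1 = r + 2 from rfl] at h2
    linear_combination (-(Polynomial.C τ⁻¹ ^ (2 * s)) * Polynomial.C (framing (τ ^ 2) s)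
        * columnCoeff q τ r (s + 1)) * h1
      - Polynomial.C (framing (τ ^ 2) s) * columnCoeff q τ (r + 2) s * h2
      + Polynomial.C (framing (τ ^ 2) (r + 1)) * columnCoeff q τ 0 (r + 1)
        * Polynomial.C (framing (τ ^ 2) s) * h3
  · rw [columnCoeff_zero_right, columnCoeff_zero_right]
    ring

end ClosedForm

/-! ### Degree in Q and nonvanishing of the top coefficient -/

section Degree

variable {K : Type*} [Field K] {q τ : K}

/-- The factor τ^n clears the odd powers of τ, so that the value is a polynomial in q over ℚ(t),
even if τ does not lie in ℚ(t). -/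
theorem pow_mul_powerSumSpec_column (hτ : τ ≠ 0) (r n : ℕ) :
    τ ^ n * powerSumSpec q τ (column r) n
      = (q ^ n - 1) * ∑ i ∈ Finset.range r, ((τ ^ 2)⁻¹ ^ i) ^ n
        + (τ ^ 2) ^ n / ((τ ^ 2) ^ n - 1) := by
  rw [powerSumSpec, colLen_column_zero, mul_add, Finset.mul_sum, Finset.mul_sum]
  congr 1
  · refine Finset.sum_congr rfl fun i hi => ?_
    have h1 : τ ^ n * τ ^ (-((n : ℤ) * (2 * (i : ℤ) + 1))) = ((τ ^ 2)⁻¹ ^ i) ^ n := by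
      rw [← zpow_natCast τ n, ← zpow_add₀ hτ, inv_pow, inv_pow, ← pow_mul, ← pow_mul, ← zpow_natCast,
        ← zpow_neg]
      congr 1
      push_cast
      ring
    rw [rowLen_column, if_pos (Finset.mem_range.1 hi), mul_one, ← h1]
    ring
  · rw [← pow_mul, mul_comm 2, pow_mul]
    have := pow_ne_zero n hτ
    generalize τ ^ n = a at *
    rw [mul_one_div, show a - a⁻¹ = (a ^ 2 - 1) / a by field_simp, div_div_eq_mul_div, sq]

theorem sq_pow_sub_one_ne (hgen : Generic q τ) (n : ℕ) : τ ^ (2 * (n + 1)) - 1 ≠ 0 := by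
  have := hgen 0 (n + 1) (by simp)
  rw [pow_zero, one_mul, ← pow_mul] at this
  rwa [sub_ne_zero]

variable [CharZero K]

/-- If `p_n` has degree at most `n`, then `e_r` has degree at most `r`, and its top coefficient is
obtained from the top coefficients of the `p_n`. -/
theorem natDegree_coeff_genSeries_le {p : ℕ → K[X]} {p' : ℕ → K} (hp : ∀ n, (p n).natDegree ≤ n)
    (hp' : ∀ n, (p n).coeff n = p' n) (r : ℕ) :
    (PowerSeries.coeff r (genSeries p)).natDegree ≤ r ∧
      (PowerSeries.coeff r (genSeries p)).coeff r = PowerSeries.coeff r (genSeries p') := by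
  induction r using Nat.strong_induction_on with
  | _ r ih =>
    rcases r with _ | r
    · simp
    · have h1 : ((r : K) + 1) ≠ 0 := Nat.cast_add_one_ne_zero r
      have h2 := newton_genSeries p r
      have h3 := newton_genSeries p' r
      have h4 : PowerSeries.coeff (r + 1) (genSeries p) = Polynomial.C ((r : K) + 1)⁻¹ *
          -∑ k ∈ Finset.range (r + 1), p (k + 1) * PowerSeries.coeff (r - k) (genSeries p) := by
        rw [← h2, ← mul_assoc]
        have : Polynomial.C ((r : K) + 1)⁻¹ * ((r : K[X]) + 1) = 1 := by
          rw [show ((r : K[X]) + 1) = Polynomial.C ((r : K) + 1) by simp, ← map_mul,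
            inv_mul_cancel₀ h1, map_one]
        rw [this, one_mul]
      constructor
      · rw [h4]
        refine (Polynomial.natDegree_C_mul_le _ _).trans ?_
        rw [Polynomial.natDegree_neg]
        refine Polynomial.natDegree_sum_le_of_forall_le _ _ fun k hk => ?_
        have hk' := Finset.mem_range.1 hk
        refine Polynomial.natDegree_mul_le.trans ?_
        have h5 := (ih (r - k) (by omega)).1
        have h6 := hp (k + 1)
        omega
      · rw [h4, Polynomial.coeff_C_mul, Polynomial.coeff_neg, Polynomial.finsetSum_coeff,
          Finset.sum_congr rfl (g := fun k => p' (k + 1) *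
            PowerSeries.coeff (r - k) (genSeries p')), ← h3, ← mul_assoc, inv_mul_cancel₀ h1,
          one_mul]
        intro k hk
        have hk' := Finset.mem_range.1 hk
        have h5 := ih (r - k) (by omega)
        rw [← h5.2, ← hp', show r + 1 = (k + 1) + (r - k) by omega,
          Polynomial.coeff_mul_add_eq_of_natDegree_le (hp (k + 1)) h5.1]

/-- For n > 0 the coefficient of Q^n in `powerSumSpecQ` is `powerSumSpec`: the alphabet t^{-ρ} only
affects the constant term. -/
theorem natDegree_columnCoeff_le (q τ : K) (r s : ℕ) :
    (columnCoeff q τ r s).natDegree ≤ s ∧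
      (columnCoeff q τ r s).coeff s = rowCoeff q τ (column r) s := by
  have hne : ∀ n, (powerSumSpecQ q τ (column r) n).natDegree ≤ n := fun n => by
    rw [powerSumSpecQ]
    compute_degree
  have hco : ∀ n, (powerSumSpecQ q τ (column r) (n + 1)).coeff (n + 1)
      = powerSumSpec q τ (column r) (n + 1) := fun n => by
    rw [powerSumSpecQ, powerSumSpec, Polynomial.coeff_add, Polynomial.coeff_mul_C,
      Polynomial.coeff_mul_C, Polynomial.coeff_sub, Polynomial.coeff_X_pow, if_pos rfl,
      Polynomial.coeff_one, if_neg (Nat.succ_ne_zero n)]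
    ring
  have h := natDegree_coeff_genSeries_le (p' := fun n => (powerSumSpecQ q τ (column r) n).coeff n)
    hne (fun n => rfl) s
  rwa [genSeries_congr (p' := powerSumSpec q τ (column r)) hco] at h

/-- By `rowCoeff_bot` a zero at r + 1 would propagate down to r, and the value at 0 is 1. -/
theorem rowCoeff_bot_ne_zero (hq : q ≠ 0) (hτ : τ ≠ 0) (hgen : Generic q τ) (r : ℕ) :
    rowCoeff q τ ⊥ r ≠ 0 := by
  induction r with
  | zero => rw [rowCoeff_zero]; exact one_ne_zero
  | succ r ih =>
    intro h
    have := rowCoeff_bot hq hτ hgen r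
    rw [h, mul_zero, add_zero] at this
    exact ih this

open scoped IntermediateField.algebraAdjoinAdjoin in
theorem transcendental_of_algebraicIndependent {q t : K} (h : AlgebraicIndependent ℚ ![q, t]) :
    Transcendental (IntermediateField.adjoin ℚ {t}) q := by
  have h1 := h.transcendental_adjoin (s := {1}) (i := 0) (by simp)
  rw [Set.image_singleton] at h1
  intro h2
  exact h1 ((IsFractionRing.isAlgebraic_iff (Algebra.adjoin ℚ {t})
    (IntermediateField.adjoin ℚ {t}) K).2 h2)

/-- For algebraically independent parameters `e_s(q^{(1^r)} t^ρ)` does not vanish: it is a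
polynomial in `q` over `ℚ(t)`, up to a power of `t^{1/2}`, and nonzero at `q = 1`. -/
theorem rowCoeff_column_ne_zero (hq : q ≠ 0) (hτ : τ ≠ 0) (hgen : Generic q τ)
    (h : AlgebraicIndependent ℚ ![q, τ ^ 2]) (r s : ℕ) : rowCoeff q τ (column r) s ≠ 0 := by
  have htr := transcendental_of_algebraicIndependent h
  set L := IntermediateField.adjoin ℚ {τ ^ 2} with hL
  let T : L := ⟨τ ^ 2, IntermediateField.mem_adjoin_simple_self ℚ (τ ^ 2)⟩
  let p : ℕ → L[X] := fun n => (Polynomial.X ^ n - 1) *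
    Polynomial.C (∑ i ∈ Finset.range r, (T⁻¹ ^ i) ^ n) + Polynomial.C (T ^ n / (T ^ n - 1))
  have hT : algebraMap L K T = τ ^ 2 := rfl
  have hp : ∀ (x : K) (n : ℕ), (Polynomial.aeval x (p n) : K)
      = (x ^ n - 1) * ∑ i ∈ Finset.range r, ((τ ^ 2)⁻¹ ^ i) ^ n
        + (τ ^ 2) ^ n / ((τ ^ 2) ^ n - 1) := fun x n => by
    simp only [p, map_add, map_mul, map_sub, map_pow, map_one, Polynomial.aeval_X,
      Polynomial.aeval_C, map_sum, map_inv₀, map_div₀, hT]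
  have hmap : ∀ x : K, (Polynomial.aeval x (PowerSeries.coeff s (genSeries p)) : K)
      = PowerSeries.coeff s (genSeries fun n => (Polynomial.aeval x (p n) : K)) := fun x => by
    have := congrArg (PowerSeries.coeff s) (map_genSeries (Polynomial.aeval x).toRingHom p)
    rwa [PowerSeries.coeff_map] at this
  have hscale : ∀ r', PowerSeries.coeff s (genSeries fun n => τ ^ n *
      powerSumSpec q τ (column r') n) = τ ^ s * rowCoeff q τ (column r') s := fun r' => by
    rw [genSeries_scale, PowerSeries.coeff_rescale]
    rfl
  -- At q = 1 the column drops out and e_s(t^ρ) remains, up to sign and a power of τ.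
  have hone : (Polynomial.aeval (1 : K) (PowerSeries.coeff s (genSeries p)) : K) ≠ 0 := by
    have h1 : (fun n => (Polynomial.aeval (1 : K) (p n) : K))
        = fun n => τ ^ n * powerSumSpec q τ (column 0) n := by
      ext n
      rw [hp, pow_mul_powerSumSpec_column hτ]
      simp
    rw [hmap, h1, hscale, column_zero]
    exact mul_ne_zero (pow_ne_zero _ hτ) (rowCoeff_bot_ne_zero hq hτ hgen s)
  have hqe : (Polynomial.aeval q (PowerSeries.coeff s (genSeries p)) : K)
      = τ ^ s * rowCoeff q τ (column r) s := by
    rw [hmap, ← hscale]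
    congr 2
    ext n
    rw [hp, pow_mul_powerSumSpec_column hτ]
  intro h0
  rw [h0, mul_zero] at hqe
  -- A root at the transcendental q forces the polynomial to be zero, against its value at 1.
  refine hone ?_
  rw [(transcendental_iff.1 htr) _ hqe, map_zero]

end Degree

/-! ### Comparison of the correlators with the closed form -/

section HopfLinkInvariant

variable {K : Type*} [Field K] [CharZero K] {q τ : K}

/-- The recursion is linear, so the closed form, mapped into K[[Q]] and multiplied by the correlator
at (0, 0), is again a solution, now with the right initial value. -/
theorem correlator_eq (hq : q ≠ 0) (hτ : τ ≠ 0) (hgen : Generic q τ) (r s : ℕ) :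
    correlator q τ r s = correlator q τ 0 0 *
      ((Polynomial.C (framing (τ ^ 2) r * framing (τ ^ 2) s) * columnCoeff q τ 0 r
        * columnCoeff q τ r s : K[X]) : PowerSeries K) := by
  have hb := ((hopfRecursion_columnCoeff hτ hgen).map
    Polynomial.coeToPowerSeries.ringHom).const_mul (correlator q τ 0 0)
  simp only [Polynomial.coeToPowerSeries.ringHom_apply, Polynomial.coe_X, Polynomial.coe_C] at hb
  refine (hopfRecursion_correlator hq hτ hgen).unique hb ?_ (fun n h => ?_) ?_ r s
  · rw [Ne, map_eq_zero_iff _ PowerSeries.C_injective]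
    exact inv_ne_zero hτ
  · refine sq_pow_sub_one_ne hgen n ?_
    rw [← map_pow, ← map_one (PowerSeries.C (R := K)), ← map_sub] at h
    exact (map_eq_zero_iff _ PowerSeries.C_injective).1 h
  · simp [columnCoeff_zero_right, framing]

theorem elemSymm_mul_elemSymm (q τ : K) (r s : ℕ) :
    Polynomial.C (framing (τ ^ 2) r * framing (τ ^ 2) s)
        * elemSymm (powerSumSpecQ q τ ⊥) r * elemSymm (powerSumSpecQ q τ (column r)) s
      = (-1) ^ (r + s) * (Polynomial.C (framing (τ ^ 2) r * framing (τ ^ 2) s)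
        * columnCoeff q τ 0 r * columnCoeff q τ r s) := by
  rw [elemSymm_eq, elemSymm_eq, columnCoeff, columnCoeff, columnSeries, columnSeries, column_zero,
    pow_add]
  ring

theorem Z_mul_inv (hq : q ≠ 0) (hτ : τ ≠ 0) (hgen : Generic q τ) (r s : ℕ) :
    Z q τ (column r) (column s) * (Z q τ ⊥ ⊥)⁻¹
      = ((Polynomial.C (framing (τ ^ 2) r * framing (τ ^ 2) s)
        * elemSymm (powerSumSpecQ q τ ⊥) r
        * elemSymm (powerSumSpecQ q τ (column r)) s : K[X]) : PowerSeries K) := by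
  have h0 : PowerSeries.constantCoeff (Z q τ ⊥ ⊥) ≠ 0 := by
    rw [constantCoeff_Z_bot_bot]; exact one_ne_zero
  have h1 := PowerSeries.mul_inv_cancel _ h0
  rw [elemSymm_mul_elemSymm, Z_column_column, correlator_eq hq hτ hgen, ← Z_bot_bot]
  generalize Polynomial.C (framing (τ ^ 2) r * framing (τ ^ 2) s) * columnCoeff q τ 0 r
    * columnCoeff q τ r s = P
  have h2 : (((-1) ^ (r + s) * P : K[X]) : PowerSeries K) = (-1) ^ (r + s) * (P : PowerSeries K) := by
    simp
  rw [h2]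
  linear_combination ((-1) ^ (r + s) * (P : PowerSeries K)) * h1

theorem natDegree_closedForm_le (q τ : K) (r s : ℕ) :
    (Polynomial.C (framing (τ ^ 2) r * framing (τ ^ 2) s) * columnCoeff q τ 0 r
        * columnCoeff q τ r s).natDegree ≤ r + s ∧
      (Polynomial.C (framing (τ ^ 2) r * framing (τ ^ 2) s) * columnCoeff q τ 0 r
        * columnCoeff q τ r s).coeff (r + s)
        = framing (τ ^ 2) r * framing (τ ^ 2) s * rowCoeff q τ ⊥ r
          * rowCoeff q τ (column r) s := by
  obtain ⟨h1, h2⟩ := natDegree_columnCoeff_le q τ 0 r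
  obtain ⟨h3, h4⟩ := natDegree_columnCoeff_le q τ r s
  rw [mul_assoc]
  constructor
  · refine (Polynomial.natDegree_C_mul_le _ _).trans (Polynomial.natDegree_mul_le.trans ?_)
    omega
  · rw [Polynomial.coeff_C_mul, Polynomial.coeff_mul_add_eq_of_natDegree_le h1 h3, h2, h4,
      column_zero, mul_assoc (framing (τ ^ 2) r * framing (τ ^ 2) s)]

theorem framing_ne_zero (hτ : τ ≠ 0) (r : ℕ) : framing (τ ^ 2) r ≠ 0 :=
  mul_ne_zero (pow_ne_zero _ (neg_ne_zero.2 one_ne_zero))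
    (inv_ne_zero (pow_ne_zero _ (pow_ne_zero _ hτ)))

end HopfLinkInvariant

end

end HopfLink



theorem proposition4p5 {K : Type*} [Field K] [CharZero K] (q τ : K) (hq : q ≠ 0) (hτ : τ ≠ 0)
    (hgen : ∀ m n : ℕ, (m, n) ≠ (0, 0) → q ^ m * (τ ^ 2) ^ n ≠ 1) (r s : ℕ) :
    IsUnit (HopfLink.Z q τ ⊥ ⊥) ∧
    ∃ P : Polynomial K,
      P = Polynomial.C (HopfLink.framing (τ ^ 2) r * HopfLink.framing (τ ^ 2) s)
          * HopfLink.elemSymm (HopfLink.powerSumSpecQ q τ ⊥) r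
          * HopfLink.elemSymm (HopfLink.powerSumSpecQ q τ (HopfLink.column r)) s ∧
      HopfLink.Z q τ (HopfLink.column r) (HopfLink.column s) * (HopfLink.Z q τ ⊥ ⊥)⁻¹
        = (P : PowerSeries K) ∧
      P.degree ≤ ((r + s : ℕ) : WithBot ℕ) ∧
      (AlgebraicIndependent ℚ ![q, τ ^ 2] → P.degree = ((r + s : ℕ) : WithBot ℕ)) := by
  refine ⟨?_, _, rfl, HopfLink.Z_mul_inv hq hτ hgen r s, ?_, fun hind => ?_⟩
  · rw [PowerSeries.isUnit_iff_constantCoeff, HopfLink.constantCoeff_Z_bot_bot]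
    exact isUnit_one
  all_goals
    obtain ⟨hdeg, hcoeff⟩ := HopfLink.natDegree_closedForm_le q τ r s
    rw [HopfLink.elemSymm_mul_elemSymm]
    rcases neg_one_pow_eq_or (Polynomial K) (r + s) with hsign | hsign <;>
    rw [hsign]
  · rw [one_mul]
    exact Polynomial.degree_le_of_natDegree_le hdeg
  · rw [neg_one_mul, Polynomial.degree_neg]
    exact Polynomial.degree_le_of_natDegree_le hdeg
  all_goals
    have hne := mul_ne_zero (mul_ne_zero (mul_ne_zero (HopfLink.framing_ne_zero hτ r)
      (HopfLink.framing_ne_zero hτ s)) (HopfLink.rowCoeff_bot_ne_zero hq hτ hgen r))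
      (HopfLink.rowCoeff_column_ne_zero hq hτ hgen hind r s)
    rw [← hcoeff] at hne
  · rw [one_mul]
    exact Polynomial.degree_eq_of_le_of_coeff_ne_zero
      (Polynomial.degree_le_of_natDegree_le hdeg) hne
  · rw [neg_one_mul, Polynomial.degree_neg]
    exact Polynomial.degree_eq_of_le_of_coeff_ne_zero
      (Polynomial.degree_le_of_natDegree_le hdeg) hne
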